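/- Let $\mathrm{Alg}_2(\mathbb{C})$ be the symmetric monoidal $2$-category whose objects are the associative unital $\mathbb{C}$-algebras, whose $1$-morphisms $R\to S$ are the $S$-$R$-bimodules (with $\mathbb{C}$ acting in the same way on both sides), whose $2$-morphisms are the bimodule homomorphisms (intertwiners), whose composition of $1$-morphisms is $({}_TN_S)\circ({}_SM_R)=N\otimes_S M$, and whose monoidal product is $\otimes_{\mathbb{C}}$ with unit $\mathbb{C}$. An object $X$ is dualizable, with dual $Y$, if there are $1$-morphisms $\mathrm{ev}:X\otimes Y\to\mathbb{C}$ and $\mathrm{coev}:\mathbb{C}\to Y\otimes X$ whose two zigzag composites $X\to X\otimes Y\otimes X\to X$ and $Y\to Y\otimes X\otimes Y\to Y$ are isomorphic to the identity $1$-morphisms. A $1$-morphism $f$ is left adjoint to $g$ (and $g$ right adjoint to $f$) if there are $2$-morphisms $1\to g\circ f$ and $f\circ g\to 1$ satisfying the triangle identities. An object is fully dualizable if it belongs to a symmetric monoidal sub-$2$-category (containing all $2$-morphisms between its $1$-morphisms) that has duals, i.e. in which every object has a dual and every $1$-morphism has both a left and a right adjoint. Theorem. A $\mathbb{C}$-algebra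 $A$ is fully dualizable in $\mathrm{Alg}_2(\mathbb{C})$ if and only if $A$ is semisimple and finitely generated as a $\mathbb{C}$-module (i.e. finite-dimensional over $\mathbb{C}$). Likewise, $A$ has a dual in $\mathrm{Alg}_2(\mathbb{C})$ whose evaluation $1$-morphism has both a left and a right adjoint if and only if $A$ is semisimple and finite-dimensional over $\mathbb{C}$. -/

import Mathlib

open CategoryTheory TensorProduct MulOpposite

universe u

/-- An object of the 2-category `Alg₂(k)`: an associative unital `k`-algebra. -/
structure Alg₂ (k : Type) [Field k] : Type (u + 1) where
  of ::
  carrier : Type u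
  [ring : Ring carrier]
  [algebra : Algebra k carrier]

namespace Alg₂

variable {k : Type} [Field k]

instance : CoeSort (Alg₂.{u} k) (Type u) := ⟨carrier⟩

attribute [instance] ring algebra

/-- An `S`-`R`-bimodule over `k` (left action of `S`, right action of `R`, the two actions commute,
and `k` acts in the same way from both sides). It is a 1-morphism `R ⟶ S`. -/
structure Bimodule (R S : Alg₂.{u} k) : Type (u + 1) where
  carrier : Type u
  [addCommGroup : AddCommGroup carrier]
  [module : Module k carrier]
  /-- the left action of `S` -/
  left : S →ₐ[k] Module.End k carrier
  /-- the right action of `R` -/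
  right : Rᵐᵒᵖ →ₐ[k] Module.End k carrier
  comm : ∀ (s : S) (r : Rᵐᵒᵖ) (m : carrier), left s (right r m) = right r (left s m)

instance (R S : Alg₂.{u} k) : CoeSort (Bimodule R S) (Type u) := ⟨Bimodule.carrier⟩

attribute [instance] Bimodule.addCommGroup Bimodule.module

/-- An intertwiner: a homomorphism of bimodules. -/
@[ext]
structure Intertwiner {R S : Alg₂.{u} k} (M N : Bimodule R S) : Type u where
  lin : M →ₗ[k] N
  map_left : ∀ (s : S) (m : M), lin (M.left s m) = N.left s (lin m)
  map_right : ∀ (r : Rᵐᵒᵖ) (m : M), lin (M.right r m) = N.right r (lin m)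

instance (R S : Alg₂.{u} k) : Category.{u} (Bimodule R S) where
  Hom M N := Intertwiner M N
  id M := ⟨LinearMap.id, fun _ _ => rfl, fun _ _ => rfl⟩
  comp f g := ⟨g.lin ∘ₗ f.lin, fun s m => by simp [f.map_left, g.map_left],
    fun r m => by simp [f.map_right, g.map_right]⟩

@[ext]
theorem Bimodule.hom_ext {R S : Alg₂.{u} k} {M N : Bimodule R S} {f g : M ⟶ N}
    (h : f.lin = g.lin) : f = g :=
  Intertwiner.ext h

@[simp]
theorem id_lin {R S : Alg₂.{u} k} (M : Bimodule R S) :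
    Intertwiner.lin (𝟙 M) = LinearMap.id := rfl

@[simp]
theorem comp_lin {R S : Alg₂.{u} k} {L M N : Bimodule R S} (f : L ⟶ M) (g : M ⟶ N) :
    Intertwiner.lin (f ≫ g) = g.lin ∘ₗ f.lin := rfl

/-- Build an isomorphism of bimodules from two mutually inverse maps. -/
def mkIso {R S : Alg₂.{u} k} {M N : Bimodule R S} (f : M ⟶ N) (g : N →ₗ[k] M)
    (h₁ : g ∘ₗ f.lin = LinearMap.id) (h₂ : f.lin ∘ₗ g = LinearMap.id) : M ≅ N where
  hom := f
  inv :=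
    { lin := g
      map_left := fun s m => by
        have e₁ : ∀ x, g (f.lin x) = x := fun x => LinearMap.congr_fun h₁ x
        have e₂ : ∀ x, f.lin (g x) = x := fun x => LinearMap.congr_fun h₂ x
        conv_lhs => rw [← e₂ m, ← f.map_left, e₁]
      map_right := fun s m => by
        have e₁ : ∀ x, g (f.lin x) = x := fun x => LinearMap.congr_fun h₁ x
        have e₂ : ∀ x, f.lin (g x) = x := fun x => LinearMap.congr_fun h₂ x
        conv_lhs => rw [← e₂ m, ← f.map_right, e₁] }
  hom_inv_id := Bimodule.hom_ext h₁
  inv_hom_id := Bimodule.hom_ext h₂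

/-- Precompose a bilinear map with a linear map in the second variable. -/
def rcomp {L M N P : Type*} [AddCommGroup L] [Module k L] [AddCommGroup M] [Module k M]
    [AddCommGroup N] [Module k N] [AddCommGroup P] [Module k P]
    (f : N →ₗ[k] M →ₗ[k] P) (g : L →ₗ[k] M) : N →ₗ[k] L →ₗ[k] P where
  toFun y := f y ∘ₗ g
  map_add' a b := by ext; simp
  map_smul' a b := by ext; simp

@[simp]
theorem rcomp_apply {L M N P : Type*} [AddCommGroup L] [Module k L] [AddCommGroup M] [Module k M]
    [AddCommGroup N] [Module k N] [AddCommGroup P] [Module k P]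
    (f : N →ₗ[k] M →ₗ[k] P) (g : L →ₗ[k] M) (y : N) (x : L) : rcomp f g y x = f y (g x) := (rfl)

/-! ### The balanced tensor product `N ⊗_S M` -/

section Balanced

variable {R S T : Alg₂.{u} k}

/-- The relations `y s ⊗ x = y ⊗ s x` in `N ⊗_k M`. -/
def balancedRel (N : Bimodule S T) (M : Bimodule R S) : Submodule k (N ⊗[k] M) :=
  Submodule.span k {z | ∃ (y : N) (s : S) (x : M),
    z = (N.right (op s) y) ⊗ₜ[k] x - y ⊗ₜ[k] (M.left s x)}

/-- The `k`-module underlying `N ⊗_S M`. -/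
def Balanced (N : Bimodule S T) (M : Bimodule R S) : Type u :=
  (N ⊗[k] M) ⧸ balancedRel N M

instance (N : Bimodule S T) (M : Bimodule R S) : AddCommGroup (Balanced N M) :=
  inferInstanceAs (AddCommGroup ((N ⊗[k] M) ⧸ balancedRel N M))

instance (N : Bimodule S T) (M : Bimodule R S) : Module k (Balanced N M) :=
  inferInstanceAs (Module k ((N ⊗[k] M) ⧸ balancedRel N M))

/-- The pure tensor `y ⊗ x` in `N ⊗_S M`, as a bilinear map. -/
def bmk (N : Bimodule S T) (M : Bimodule R S) : N →ₗ[k] M →ₗ[k] Balanced N M :=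
  (TensorProduct.mk k N M).compr₂ (balancedRel N M).mkQ

theorem bmk_smul (N : Bimodule S T) (M : Bimodule R S) (y : N) (s : S) (x : M) :
    bmk N M (N.right (op s) y) x = bmk N M y (M.left s x) :=
  (Submodule.Quotient.eq _).2 (Submodule.subset_span ⟨y, s, x, rfl⟩)

@[ext]
theorem balanced_ext {N : Bimodule S T} {M : Bimodule R S} {P : Type*} [AddCommGroup P]
    [Module k P] {f g : Balanced N M →ₗ[k] P} (h : ∀ y x, f (bmk N M y x) = g (bmk N M y x)) :
    f = g :=
  Submodule.linearMap_qext (balancedRel N M) (TensorProduct.ext' h)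

/-- The universal property of `N ⊗_S M`. -/
def blift {N : Bimodule S T} {M : Bimodule R S} {P : Type*} [AddCommGroup P] [Module k P]
    (f : N →ₗ[k] M →ₗ[k] P) (h : ∀ y s x, f (N.right (op s) y) x = f y (M.left s x)) :
    Balanced N M →ₗ[k] P :=
  (balancedRel N M).liftQ (TensorProduct.lift f) <| Submodule.span_le.2 <| by
    rintro _ ⟨y, s, x, rfl⟩
    simp [h]

@[simp]
theorem blift_bmk {N : Bimodule S T} {M : Bimodule R S} {P : Type*} [AddCommGroup P] [Module k P]
    (f : N →ₗ[k] M →ₗ[k] P) (h : ∀ y s x, f (N.right (op s) y) x = f y (M.left s x))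
    (y : N) (x : M) : blift f h (bmk N M y x) = f y x := by
  rfl

theorem lact_aux (N : Bimodule S T) (M : Bimodule R S) (t : T) (y : N) (s : S) (x : M) :
    (bmk N M).comp (N.left t) (N.right (op s) y) x = (bmk N M).comp (N.left t) y (M.left s x) := by
  simp only [LinearMap.comp_apply]
  rw [N.comm, bmk_smul]

theorem ract_aux (N : Bimodule S T) (M : Bimodule R S) (r : Rᵐᵒᵖ) (y : N) (s : S) (x : M) :
    rcomp (bmk N M) (M.right r) (N.right (op s) y) x =
      rcomp (bmk N M) (M.right r) y (M.left s x) := by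
  simp only [rcomp_apply]
  rw [bmk_smul, M.comm]

/-- `t (y ⊗ x) = t y ⊗ x`. -/
def lact (N : Bimodule S T) (M : Bimodule R S) (t : T) : Balanced N M →ₗ[k] Balanced N M :=
  blift ((bmk N M).comp (N.left t)) (lact_aux N M t)

/-- `(y ⊗ x) r = y ⊗ x r`. -/
def ract (N : Bimodule S T) (M : Bimodule R S) (r : Rᵐᵒᵖ) : Balanced N M →ₗ[k] Balanced N M :=
  blift (rcomp (bmk N M) (M.right r)) (ract_aux N M r)

@[simp]
theorem lact_bmk (N : Bimodule S T) (M : Bimodule R S) (t : T) (y : N) (x : M) :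
    lact N M t (bmk N M y x) = bmk N M (N.left t y) x := blift_bmk _ (lact_aux N M t) _ _

@[simp]
theorem ract_bmk (N : Bimodule S T) (M : Bimodule R S) (r : Rᵐᵒᵖ) (y : N) (x : M) :
    ract N M r (bmk N M y x) = bmk N M y (M.right r x) := blift_bmk _ (ract_aux N M r) _ _

/-- The `T`-`R`-bimodule `N ⊗_S M`, with `t (y ⊗ x) r = t y ⊗ x r`. -/
def tensorOver (N : Bimodule S T) (M : Bimodule R S) : Bimodule R T where
  carrier := Balanced N M
  left := AlgHom.ofLinearMap
    { toFun := fun t => lact N M t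
      map_add' := fun a b => balanced_ext (by simp)
      map_smul' := fun a b => balanced_ext (by simp) }
    (balanced_ext (by simp)) (fun a b => balanced_ext (by simp))
  right := AlgHom.ofLinearMap
    { toFun := fun r => ract N M r
      map_add' := fun a b => balanced_ext (by simp)
      map_smul' := fun a b => balanced_ext (by simp) }
    (balanced_ext (by simp)) (fun a b => balanced_ext (by simp))
  comm t r := LinearMap.congr_fun (f := lact N M t ∘ₗ ract N M r)
    (g := ract N M r ∘ₗ lact N M t) (balanced_ext (by simp))

/-- The pure tensor `y ⊗ x`, as an element of the bimodule `N ⊗_S M`. -/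
def tmk (N : Bimodule S T) (M : Bimodule R S) : N →ₗ[k] M →ₗ[k] tensorOver N M := bmk N M

theorem tmk_smul (N : Bimodule S T) (M : Bimodule R S) (y : N) (s : S) (x : M) :
    tmk N M (N.right (op s) y) x = tmk N M y (M.left s x) := bmk_smul N M y s x

theorem tmk_ext {N : Bimodule S T} {M : Bimodule R S} {P : Type*} [AddCommGroup P]
    [Module k P] {f g : tensorOver N M →ₗ[k] P} (h : ∀ y x, f (tmk N M y x) = g (tmk N M y x)) :
    f = g := balanced_ext h

theorem tmk_ext_apply {N : Bimodule S T} {M : Bimodule R S} {P : Type*} [AddCommGroup P]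
    [Module k P] (f g : tensorOver N M →ₗ[k] P) (h : ∀ y x, f (tmk N M y x) = g (tmk N M y x))
    (z : tensorOver N M) : f z = g z := by rw [tmk_ext h]

/-- The linear map out of `N ⊗_S M` given by a balanced bilinear map. -/
def tlift {N : Bimodule S T} {M : Bimodule R S} {P : Type*} [AddCommGroup P] [Module k P]
    (f : N →ₗ[k] M →ₗ[k] P) (h : ∀ y s x, f (N.right (op s) y) x = f y (M.left s x)) :
    tensorOver N M →ₗ[k] P := blift f h

@[simp]
theorem tlift_tmk {N : Bimodule S T} {M : Bimodule R S} {P : Type*} [AddCommGroup P] [Module k P]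
    (f : N →ₗ[k] M →ₗ[k] P) (h : ∀ y s x, f (N.right (op s) y) x = f y (M.left s x))
    (y : N) (x : M) : tlift f h (tmk N M y x) = f y x := blift_bmk f h y x

@[simp]
theorem tensorOver_left (N : Bimodule S T) (M : Bimodule R S) (t : T) (y : N) (x : M) :
    (tensorOver N M).left t (tmk N M y x) = tmk N M (N.left t y) x :=
  lact_bmk N M t y x

@[simp]
theorem tensorOver_right (N : Bimodule S T) (M : Bimodule R S) (r : Rᵐᵒᵖ) (y : N) (x : M) :
    (tensorOver N M).right r (tmk N M y x) = tmk N M y (M.right r x) :=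
  ract_bmk N M r y x

/-- The intertwiner out of `N ⊗_S M` given by a balanced bilinear map compatible with the
outer actions. -/
def tdesc {N : Bimodule S T} {M : Bimodule R S} {P : Bimodule R T} (f : N →ₗ[k] M →ₗ[k] P)
    (h : ∀ y s x, f (N.right (op s) y) x = f y (M.left s x))
    (hl : ∀ t y x, f (N.left t y) x = P.left t (f y x))
    (hr : ∀ r y x, f y (M.right r x) = P.right r (f y x)) : tensorOver N M ⟶ P where
  lin := tlift f h
  map_left t := tmk_ext_apply (tlift f h ∘ₗ (tensorOver N M).left t) (P.left t ∘ₗ tlift f h)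
    (by simp [hl])
  map_right r := tmk_ext_apply (tlift f h ∘ₗ (tensorOver N M).right r) (P.right r ∘ₗ tlift f h)
    (by simp [hr])

@[simp]
theorem tdesc_tmk {N : Bimodule S T} {M : Bimodule R S} {P : Bimodule R T}
    (f : N →ₗ[k] M →ₗ[k] P) (h : ∀ y s x, f (N.right (op s) y) x = f y (M.left s x))
    (hl : ∀ t y x, f (N.left t y) x = P.left t (f y x))
    (hr : ∀ r y x, f y (M.right r x) = P.right r (f y x)) (y : N) (x : M) :
    (tdesc f h hl hr).lin (tmk N M y x) = f y x := tlift_tmk f h y x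

theorem tensorOver_hom_ext {N : Bimodule S T} {M : Bimodule R S} {P : Bimodule R T}
    {f g : tensorOver N M ⟶ P} (h : ∀ y x, f.lin (tmk N M y x) = g.lin (tmk N M y x)) : f = g :=
  Bimodule.hom_ext (tmk_ext h)

end Balanced

/-- The bimodule `S` of an algebra homomorphism `φ : R → S`, with `s · x · r = s x φ(r)`. -/
def ofAlgHom {R S : Alg₂.{u} k} (φ : R →ₐ[k] S) : Bimodule R S where
  carrier := S
  left := Algebra.lsmul k k S
  right := (Algebra.lsmul k k S : Sᵐᵒᵖ →ₐ[k] Module.End k S).comp (AlgHom.op φ)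
  comm s r m := by simp [mul_assoc]

/-- An element of `S`, seen in the bimodule `S` of `φ : R → S`. -/
def elt {R S : Alg₂.{u} k} (φ : R →ₐ[k] S) : S ≃ₗ[k] ofAlgHom φ := LinearEquiv.refl k S

@[simp]
theorem ofAlgHom_left {R S : Alg₂.{u} k} (φ : R →ₐ[k] S) (s x : S) :
    (ofAlgHom φ).left s (elt φ x) = elt φ (s * x) := rfl

@[simp]
theorem ofAlgHom_right {R S : Alg₂.{u} k} (φ : R →ₐ[k] S) (r : Rᵐᵒᵖ) (x : S) :
    (ofAlgHom φ).right r (elt φ x) = elt φ (x * φ r.unop) := rfl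

/-- The identity bimodule `R`. -/
abbrev idBimodule (R : Alg₂.{u} k) : Bimodule R R := ofAlgHom (AlgHom.id k R)

/-- An element of `R`, seen in the identity bimodule. -/
abbrev idElt (R : Alg₂.{u} k) : R ≃ₗ[k] idBimodule R := elt (AlgHom.id k R)

/-! ### The bicategory structure -/

section Bicat

variable {A B C D : Alg₂.{u} k}

/-- `N ⊗ f`. -/
def mapRight (N : Bimodule B C) {M M' : Bimodule A B} (f : M ⟶ M') :
    tensorOver N M ⟶ tensorOver N M' :=
  tdesc (rcomp (tmk N M') f.lin) (fun y s x => by simp [f.map_left, tmk_smul])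
    (fun t y x => by simp) (fun r y x => by simp [f.map_right])

/-- `f ⊗ M`. -/
def mapLeft {N N' : Bimodule B C} (f : N ⟶ N') (M : Bimodule A B) :
    tensorOver N M ⟶ tensorOver N' M :=
  tdesc ((tmk N' M).comp f.lin) (fun y s x => by simp [f.map_right, tmk_smul])
    (fun t y x => by simp [f.map_left]) (fun r y x => by simp)

@[simp]
theorem mapRight_tmk (N : Bimodule B C) {M M' : Bimodule A B} (f : M ⟶ M') (y : N) (x : M) :
    (mapRight N f).lin (tmk N M y x) = tmk N M' y (f.lin x) := tdesc_tmk _ _ _ _ _ _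

@[simp]
theorem mapLeft_tmk {N N' : Bimodule B C} (f : N ⟶ N') (M : Bimodule A B) (y : N) (x : M) :
    (mapLeft f M).lin (tmk N M y x) = tmk N' M (f.lin y) x := tdesc_tmk _ _ _ _ _ _

/-- `y ⊗ x ↦ (z ⊗ y) ⊗ x`. -/
def assocHomAux (P : Bimodule C D) (N : Bimodule B C) (M : Bimodule A B) (z : P) :
    tensorOver N M →ₗ[k] tensorOver (tensorOver P N) M :=
  tlift ((tmk (tensorOver P N) M).comp (tmk P N z)) (fun y s x => by simp [← tmk_smul])

@[simp]
theorem assocHomAux_tmk (P : Bimodule C D) (N : Bimodule B C) (M : Bimodule A B)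
    (z : P) (y : N) (x : M) :
    assocHomAux P N M z (tmk _ _ y x) = tmk _ _ (tmk _ _ z y) x := tlift_tmk _ _ _ _

/-- `P ⊗ (N ⊗ M) → (P ⊗ N) ⊗ M`. -/
def assocHom (P : Bimodule C D) (N : Bimodule B C) (M : Bimodule A B) :
    tensorOver P (tensorOver N M) ⟶ tensorOver (tensorOver P N) M :=
  tdesc
    { toFun := fun z => assocHomAux P N M z
      map_add' := fun a b => tmk_ext (by simp)
      map_smul' := fun a b => tmk_ext (by simp) }
    (fun z s => tmk_ext_apply (assocHomAux P N M (P.right (op s) z))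
      (assocHomAux P N M z ∘ₗ (tensorOver N M).left s) (by simp [tmk_smul]))
    (fun t z => tmk_ext_apply (assocHomAux P N M (P.left t z))
      ((tensorOver (tensorOver P N) M).left t ∘ₗ assocHomAux P N M z) (by simp))
    (fun r z => tmk_ext_apply (assocHomAux P N M z ∘ₗ (tensorOver N M).right r)
      ((tensorOver (tensorOver P N) M).right r ∘ₗ assocHomAux P N M z) (by simp))

@[simp]
theorem assocHom_tmk (P : Bimodule C D) (N : Bimodule B C) (M : Bimodule A B)
    (z : P) (y : N) (x : M) : (assocHom P N M).lin (tmk _ _ z (tmk _ _ y x)) =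
      tmk _ _ (tmk _ _ z y) x := by
  simp [assocHom]

/-- `z ⊗ y ↦ z ⊗ (y ⊗ x)`. -/
def assocInvAux (P : Bimodule C D) (N : Bimodule B C) (M : Bimodule A B) (x : M) :
    tensorOver P N →ₗ[k] tensorOver P (tensorOver N M) :=
  tlift (rcomp (tmk P (tensorOver N M)) ((tmk N M).flip x)) (fun y s x => by simp [tmk_smul])

@[simp]
theorem assocInvAux_tmk (P : Bimodule C D) (N : Bimodule B C) (M : Bimodule A B)
    (z : P) (y : N) (x : M) :
    assocInvAux P N M x (tmk _ _ z y) = tmk _ _ z (tmk _ _ y x) := tlift_tmk _ _ _ _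

/-- `w ↦ x ↦ assocInvAux x w`. -/
def assocInvBil (P : Bimodule C D) (N : Bimodule B C) (M : Bimodule A B) :
    tensorOver P N →ₗ[k] M →ₗ[k] tensorOver P (tensorOver N M) :=
  LinearMap.flip
    { toFun := fun x => assocInvAux P N M x
      map_add' := fun a b => tmk_ext (by simp)
      map_smul' := fun a b => tmk_ext (by simp) }

theorem assocInvBil_apply (P : Bimodule C D) (N : Bimodule B C) (M : Bimodule A B)
    (w : tensorOver P N) (x : M) : assocInvBil P N M w x = assocInvAux P N M x w := (rfl)

/-- `(P ⊗ N) ⊗ M → P ⊗ (N ⊗ M)`. -/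
def assocInv (P : Bimodule C D) (N : Bimodule B C) (M : Bimodule A B) :
    tensorOver (tensorOver P N) M →ₗ[k] tensorOver P (tensorOver N M) :=
  tlift (assocInvBil P N M) (fun y s x => by
    rw [assocInvBil_apply, assocInvBil_apply]
    exact tmk_ext_apply (assocInvAux P N M x ∘ₗ (tensorOver P N).right (op s))
      (assocInvAux P N M (M.left s x)) (by simp [tmk_smul]) y)

@[simp]
theorem assocInv_tmk (P : Bimodule C D) (N : Bimodule B C) (M : Bimodule A B)
    (z : P) (y : N) (x : M) : assocInv P N M (tmk _ _ (tmk _ _ z y) x) =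
      tmk _ _ z (tmk _ _ y x) := by
  rw [assocInv, tlift_tmk, assocInvBil_apply, assocInvAux_tmk]

/-- Linear maps out of `(P ⊗ N) ⊗ M` are determined by their values on pure tensors. -/
theorem tmk_ext₃ {P : Bimodule C D} {N : Bimodule B C} {M : Bimodule A B} {V : Type*}
    [AddCommGroup V] [Module k V] {f g : tensorOver (tensorOver P N) M →ₗ[k] V}
    (h : ∀ z y x, f (tmk _ _ (tmk _ _ z y) x) = g (tmk _ _ (tmk _ _ z y) x)) : f = g :=
  tmk_ext fun w x => tmk_ext_apply (f ∘ₗ (tmk _ M).flip x) (g ∘ₗ (tmk _ M).flip x)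
    (fun z y => h z y x) w

/-- Linear maps out of `P ⊗ (N ⊗ M)` are determined by their values on pure tensors. -/
theorem tmk_ext₃' {P : Bimodule C D} {N : Bimodule B C} {M : Bimodule A B} {V : Type*}
    [AddCommGroup V] [Module k V] {f g : tensorOver P (tensorOver N M) →ₗ[k] V}
    (h : ∀ z y x, f (tmk _ _ z (tmk _ _ y x)) = g (tmk _ _ z (tmk _ _ y x))) : f = g :=
  tmk_ext fun z w => tmk_ext_apply (f ∘ₗ tmk P _ z) (g ∘ₗ tmk P _ z) (fun y x => h z y x) w

/-- `P ⊗ (N ⊗ M) ≅ (P ⊗ N) ⊗ M`. -/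
def assocIso (P : Bimodule C D) (N : Bimodule B C) (M : Bimodule A B) :
    tensorOver P (tensorOver N M) ≅ tensorOver (tensorOver P N) M :=
  mkIso (assocHom P N M) (assocInv P N M) (tmk_ext₃' (by simp)) (tmk_ext₃ (by simp))

@[simp]
theorem assocIso_hom_tmk (P : Bimodule C D) (N : Bimodule B C) (M : Bimodule A B)
    (z : P) (y : N) (x : M) : (assocIso P N M).hom.lin (tmk _ _ z (tmk _ _ y x)) =
      tmk _ _ (tmk _ _ z y) x := assocHom_tmk P N M z y x

@[simp]
theorem assocIso_inv_tmk (P : Bimodule C D) (N : Bimodule B C) (M : Bimodule A B)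
    (z : P) (y : N) (x : M) : (assocIso P N M).inv.lin (tmk _ _ (tmk _ _ z y) x) =
      tmk _ _ z (tmk _ _ y x) := assocInv_tmk P N M z y x

/-- `y ↦ x ↦ y x`. -/
def idRightBil (M : Bimodule A B) : M →ₗ[k] idBimodule A →ₗ[k] M :=
  LinearMap.flip (M.right.toLinearMap ∘ₗ (opLinearEquiv k).toLinearMap ∘ₗ
    (idElt A).symm.toLinearMap)

@[simp]
theorem idRightBil_apply (M : Bimodule A B) (y : M) (x : A) :
    idRightBil M y (idElt A x) = M.right (op x) y := (rfl)

/-- `M ⊗_A A → M`. -/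
def idRightHom (M : Bimodule A B) : tensorOver M (idBimodule A) ⟶ M :=
  tdesc (idRightBil M)
    (fun y s x => by
      obtain ⟨x, rfl⟩ := (idElt A).surjective x
      simp)
    (fun t y x => by
      obtain ⟨x, rfl⟩ := (idElt A).surjective x
      simp [M.comm])
    (fun r y x => by
      obtain ⟨x, rfl⟩ := (idElt A).surjective x
      obtain ⟨r, rfl⟩ := op_surjective r
      simp)

/-- `y ↦ x ↦ y x`. -/
def idLeftBil (M : Bimodule A B) : idBimodule B →ₗ[k] M →ₗ[k] M :=
  M.left.toLinearMap ∘ₗ (idElt B).symm.toLinearMap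

@[simp]
theorem idLeftBil_apply (M : Bimodule A B) (y : B) (x : M) :
    idLeftBil M (idElt B y) x = M.left y x := (rfl)

/-- `B ⊗_B M → M`. -/
def idLeftHom (M : Bimodule A B) : tensorOver (idBimodule B) M ⟶ M :=
  tdesc (idLeftBil M)
    (fun y s x => by
      obtain ⟨y, rfl⟩ := (idElt B).surjective y
      simp)
    (fun t y x => by
      obtain ⟨y, rfl⟩ := (idElt B).surjective y
      simp)
    (fun r y x => by
      obtain ⟨y, rfl⟩ := (idElt B).surjective y
      simp [M.comm])

theorem tmk_idElt_right (M : Bimodule A B) (y : M) (x : A) :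
    tmk M (idBimodule A) (M.right (op x) y) (idElt A 1) = tmk M (idBimodule A) y (idElt A x) := by
  rw [tmk_smul, ofAlgHom_left, mul_one]

theorem tmk_idElt_left (M : Bimodule A B) (y : B) (x : M) :
    tmk (idBimodule B) M (idElt B 1) (M.left y x) = tmk (idBimodule B) M (idElt B y) x := by
  rw [← tmk_smul, ofAlgHom_right, one_mul]
  rfl

/-- `M ⊗_A A ≅ M`. -/
def idRight (M : Bimodule A B) : tensorOver M (idBimodule A) ≅ M :=
  mkIso (idRightHom M) ((tmk M (idBimodule A)).flip (idElt A 1))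
    (tmk_ext fun y x => by
      obtain ⟨x, rfl⟩ := (idElt A).surjective x
      simp [idRightHom, tmk_idElt_right])
    (LinearMap.ext fun y => by simp [idRightHom])

/-- `B ⊗_B M ≅ M`. -/
def idLeft (M : Bimodule A B) : tensorOver (idBimodule B) M ≅ M :=
  mkIso (idLeftHom M) (tmk (idBimodule B) M (idElt B 1))
    (tmk_ext fun y x => by
      obtain ⟨y, rfl⟩ := (idElt B).surjective y
      simp [idLeftHom, tmk_idElt_left])
    (LinearMap.ext fun y => by simp [idLeftHom])

@[simp]
theorem idRight_hom_tmk (M : Bimodule A B) (y : M) (x : A) :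
    (idRight M).hom.lin (tmk M (idBimodule A) y (idElt A x)) = M.right (op x) y := by
  simp [idRight, idRightHom, mkIso]

@[simp]
theorem idLeft_hom_tmk (M : Bimodule A B) (y : B) (x : M) :
    (idLeft M).hom.lin (tmk (idBimodule B) M (idElt B y) x) = M.left y x := by
  simp [idLeft, idLeftHom, mkIso]

@[simp]
theorem idRight_inv (M : Bimodule A B) (y : M) :
    (idRight M).inv.lin y = tmk M (idBimodule A) y (idElt A 1) := rfl

@[simp]
theorem idLeft_inv (M : Bimodule A B) (x : M) :
    (idLeft M).inv.lin x = tmk (idBimodule B) M (idElt B 1) x := rfl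

end Bicat

/-- The 2-category of algebras, bimodules and intertwiners. The composite of `f : R ⟶ S` and
`g : S ⟶ T` is the `T`-`R`-bimodule `g ⊗_S f`. -/
instance : Bicategory (Alg₂.{u} k) where
  Hom R S := Bimodule R S
  id R := idBimodule R
  comp f g := tensorOver g f
  homCategory _ _ := inferInstance
  whiskerLeft f _ _ η := mapLeft η f
  whiskerRight η h := mapRight h η
  associator f g h := assocIso h g f
  leftUnitor f := idRight f
  rightUnitor f := idLeft f
  whiskerLeft_id f g := tensorOver_hom_ext fun y x => by simp
  whiskerLeft_comp f _ _ _ η θ := tensorOver_hom_ext fun y x => by simp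
  id_whiskerLeft {A B M N} η := tensorOver_hom_ext fun y x => by
    obtain ⟨x, rfl⟩ := (idElt A).surjective x
    simp [η.map_right, tmk_idElt_right]
  comp_whiskerLeft f g _ _ η := Bimodule.hom_ext <| tmk_ext₃' fun z y x => by simp
  id_whiskerRight f g := tensorOver_hom_ext fun y x => by simp
  comp_whiskerRight η θ i := tensorOver_hom_ext fun y x => by simp
  whiskerRight_id {A B M N} η := tensorOver_hom_ext fun y x => by
    obtain ⟨y, rfl⟩ := (idElt B).surjective y
    simp [η.map_left, tmk_idElt_left]
  whiskerRight_comp η g h := Bimodule.hom_ext <| tmk_ext₃ fun z y x => by simp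
  whisker_assoc f _ _ η h := Bimodule.hom_ext <| tmk_ext₃' fun z y x => by simp
  whisker_exchange η θ := tensorOver_hom_ext fun y x => by simp
  pentagon f g h i := Bimodule.hom_ext <| tmk_ext fun w v => by
    refine tmk_ext_apply
      (Intertwiner.lin (mapRight i (assocIso h g f).hom ≫ (assocIso i (tensorOver h g) f).hom ≫
        mapLeft (assocIso i h g).hom f) ∘ₗ tmk i _ w)
      (Intertwiner.lin ((assocIso i h (tensorOver g f)).hom ≫
        (assocIso (tensorOver i h) g f).hom) ∘ₗ tmk i _ w) (fun z u => ?_) v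
    refine tmk_ext_apply
      (Intertwiner.lin (mapRight i (assocIso h g f).hom ≫ (assocIso i (tensorOver h g) f).hom ≫
        mapLeft (assocIso i h g).hom f) ∘ₗ tmk i _ w ∘ₗ tmk h _ z)
      (Intertwiner.lin ((assocIso i h (tensorOver g f)).hom ≫
        (assocIso (tensorOver i h) g f).hom) ∘ₗ tmk i _ w ∘ₗ tmk h _ z) (fun y x => ?_) u
    simp
  triangle {A B C} f g := Bimodule.hom_ext <| tmk_ext₃' fun z y x => by
    obtain ⟨y, rfl⟩ := (idElt B).surjective y
    simp [tmk_smul]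

/-! ### The symmetric monoidal structure -/

section Monoidal

/-- The tensor product `A ⊗_k B` of two algebras. -/
def tensorObj (A B : Alg₂.{u} k) : Alg₂.{u} k := of (A ⊗[k] B)

/-- The monoidal unit: the ground field `k`, placed in the universe of the algebras. -/
def unitObj (k : Type) [Field k] : Alg₂.{u} k := of (ULift.{u} k)

variable {A B C D : Alg₂.{u} k}

/-- The left action of `B ⊗ D` on `M ⊗_k N`. -/
def tensorLeft (M : Bimodule A B) (N : Bimodule C D) :
    B ⊗[k] D →ₐ[k] Module.End k (M ⊗[k] N) :=
  (Module.endTensorEndAlgHom (R := k) (S := k) (A := k) (M := M) (N := N)).comp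
    (Algebra.TensorProduct.map M.left N.left)

/-- The right action of `A ⊗ C` on `M ⊗_k N`. -/
def tensorRight (M : Bimodule A B) (N : Bimodule C D) :
    (A ⊗[k] C)ᵐᵒᵖ →ₐ[k] Module.End k (M ⊗[k] N) :=
  ((Module.endTensorEndAlgHom (R := k) (S := k) (A := k) (M := M) (N := N)).comp
    (Algebra.TensorProduct.map M.right N.right)).comp
      (Algebra.TensorProduct.opAlgEquiv k k A C).symm.toAlgHom

@[simp]
theorem tensorLeft_tmul (M : Bimodule A B) (N : Bimodule C D) (b : B) (d : D) (m : M) (n : N) :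
    tensorLeft M N (b ⊗ₜ d) (m ⊗ₜ n) = M.left b m ⊗ₜ N.left d n := by
  simp [tensorLeft, Module.endTensorEndAlgHom_apply]

@[simp]
theorem tensorRight_tmul (M : Bimodule A B) (N : Bimodule C D) (a : A) (c : C) (m : M) (n : N) :
    tensorRight M N (op (a ⊗ₜ c)) (m ⊗ₜ n) = M.right (op a) m ⊗ₜ N.right (op c) n := by
  simp [tensorRight, Module.endTensorEndAlgHom_apply]

theorem tensor_comm (M : Bimodule A B) (N : Bimodule C D) (s : B ⊗[k] D) (r : A ⊗[k] C)
    (z : M ⊗[k] N) :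
    tensorLeft M N s (tensorRight M N (op r) z) = tensorRight M N (op r) (tensorLeft M N s z) := by
  induction z with
  | zero => simp
  | add x y hx hy => simp [hx, hy]
  | tmul m n =>
    induction s with
    | zero => simp
    | add x y hx hy => simp [hx, hy]
    | tmul b d =>
      induction r with
      | zero => simp
      | add x y hx hy => simp [hx, hy]
      | tmul a c => simp [M.comm, N.comm]

/-- The tensor product `M ⊗_k N` of 1-morphisms `M : A ⟶ B` and `N : C ⟶ D`, a 1-morphism
`A ⊗ C ⟶ B ⊗ D` with `(b ⊗ d) (m ⊗ n) (a ⊗ c) = b m a ⊗ d n c`. -/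
def tensorHom (M : A ⟶ B) (N : C ⟶ D) : tensorObj A C ⟶ tensorObj B D :=
  show Bimodule _ _ from
  { carrier := Bimodule.carrier M ⊗[k] Bimodule.carrier N
    left := tensorLeft M N
    right := tensorRight M N
    comm := fun s r z => tensor_comm M N s r.unop z }

/-- The 1-morphism given by an algebra homomorphism. -/
def homOf (φ : A →ₐ[k] B) : A ⟶ B := ofAlgHom φ

/-- The algebra isomorphism `(A ⊗ B) ⊗ C ≃ A ⊗ (B ⊗ C)`. -/
def assocEquiv (A B C : Alg₂.{u} k) :
    tensorObj (tensorObj A B) C ≃ₐ[k] tensorObj A (tensorObj B C) :=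
  Algebra.TensorProduct.assoc k k k A B C

/-- The algebra isomorphism `k ⊗ A ≃ A`. -/
def leftUnitEquiv (A : Alg₂.{u} k) : tensorObj (unitObj k) A ≃ₐ[k] A :=
  (Algebra.TensorProduct.congr (ULift.algEquiv (R := k) (A := k))
    (AlgEquiv.refl (R := k) (A₁ := A))).trans (Algebra.TensorProduct.lid k A)

/-- The algebra isomorphism `A ⊗ k ≃ A`. -/
def rightUnitEquiv (A : Alg₂.{u} k) : tensorObj A (unitObj k) ≃ₐ[k] A :=
  (Algebra.TensorProduct.congr (AlgEquiv.refl (R := k) (A₁ := A))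
    (ULift.algEquiv (R := k) (A := k))).trans (Algebra.TensorProduct.rid k k A)

/-- The algebra isomorphism `A ⊗ B ≃ B ⊗ A`. -/
def braidEquiv (A B : Alg₂.{u} k) : tensorObj A B ≃ₐ[k] tensorObj B A :=
  Algebra.TensorProduct.comm k A B

/-! ### Dualizability -/

/-- `Y` is a dual of `X`, with evaluation `ev` and coevaluation `coev`: the two zigzag composites
`X ⟶ X ⊗ k ⟶ X ⊗ (Y ⊗ X) ⟶ (X ⊗ Y) ⊗ X ⟶ k ⊗ X ⟶ X` and
`Y ⟶ k ⊗ Y ⟶ (Y ⊗ X) ⊗ Y ⟶ Y ⊗ (X ⊗ Y) ⟶ Y ⊗ k ⟶ Y` are isomorphic to identity 1-morphisms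
(that is, they are identities in the homotopy category). -/
structure IsDualPair {X Y : Alg₂.{u} k} (ev : tensorObj X Y ⟶ unitObj k)
    (coev : unitObj k ⟶ tensorObj Y X) : Prop where
  zigzag_left : Nonempty
    (homOf (rightUnitEquiv X).symm.toAlgHom ≫ tensorHom (𝟙 X) coev ≫
      homOf (assocEquiv X Y X).symm.toAlgHom ≫ tensorHom ev (𝟙 X) ≫
      homOf (leftUnitEquiv X).toAlgHom ≅ 𝟙 X)
  zigzag_right : Nonempty
    (homOf (leftUnitEquiv Y).symm.toAlgHom ≫ tensorHom coev (𝟙 Y) ≫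
      homOf (assocEquiv Y X Y).toAlgHom ≫ tensorHom (𝟙 Y) ev ≫
      homOf (rightUnitEquiv Y).toAlgHom ≅ 𝟙 Y)

/-- A symmetric monoidal sub-2-category of `Alg₂(k)`, containing all 2-morphisms between its
1-morphisms: a class of objects and a class of 1-morphisms between them, closed under
isomorphism of 1-morphisms, identities, composition, tensor products, and containing the unit,
the associativity, unit and symmetry equivalences of its objects and their inverses. -/
structure SymmetricMonoidalSub (k : Type) [Field k] where
  obj : Alg₂.{u} k → Prop
  hom : ∀ {X Y : Alg₂.{u} k}, (X ⟶ Y) → Prop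
  obj_src : ∀ {X Y : Alg₂.{u} k} (f : X ⟶ Y), hom f → obj X
  obj_tgt : ∀ {X Y : Alg₂.{u} k} (f : X ⟶ Y), hom f → obj Y
  hom_iso : ∀ {X Y : Alg₂.{u} k} (f g : X ⟶ Y), Nonempty (f ≅ g) → hom f → hom g
  hom_id : ∀ X : Alg₂.{u} k, obj X → hom (𝟙 X)
  hom_comp : ∀ {X Y Z : Alg₂.{u} k} (f : X ⟶ Y) (g : Y ⟶ Z), hom f → hom g → hom (f ≫ g)
  obj_unit : obj (unitObj k)
  obj_tensor : ∀ X Y : Alg₂.{u} k, obj X → obj Y → obj (tensorObj X Y)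
  hom_tensor : ∀ {X Y X' Y' : Alg₂.{u} k} (f : X ⟶ Y) (g : X' ⟶ Y'),
    hom f → hom g → hom (tensorHom f g)
  hom_assoc : ∀ X Y Z : Alg₂.{u} k, obj X → obj Y → obj Z →
    hom (homOf (assocEquiv X Y Z).toAlgHom) ∧ hom (homOf (assocEquiv X Y Z).symm.toAlgHom)
  hom_leftUnit : ∀ X : Alg₂.{u} k, obj X →
    hom (homOf (leftUnitEquiv X).toAlgHom) ∧ hom (homOf (leftUnitEquiv X).symm.toAlgHom)
  hom_rightUnit : ∀ X : Alg₂.{u} k, obj X →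
    hom (homOf (rightUnitEquiv X).toAlgHom) ∧ hom (homOf (rightUnitEquiv X).symm.toAlgHom)
  hom_braid : ∀ X Y : Alg₂.{u} k, obj X → obj Y → hom (homOf (braidEquiv X Y).toAlgHom)

/-- The sub-2-category has duals: each of its objects has a dual in it, and each of its
1-morphisms has a right adjoint and a left adjoint in it. -/
structure SymmetricMonoidalSub.HasDuals (S : SymmetricMonoidalSub.{u} k) : Prop where
  exists_dual : ∀ X : Alg₂.{u} k, S.obj X → ∃ (Y : Alg₂.{u} k) (ev : tensorObj X Y ⟶ unitObj k)
    (coev : unitObj k ⟶ tensorObj Y X), S.obj Y ∧ S.hom ev ∧ S.hom coev ∧ IsDualPair ev coev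
  exists_rightAdjoint : ∀ {X Y : Alg₂.{u} k} (f : X ⟶ Y), S.hom f →
    ∃ g : Y ⟶ X, S.hom g ∧ Nonempty (Bicategory.Adjunction f g)
  exists_leftAdjoint : ∀ {X Y : Alg₂.{u} k} (f : X ⟶ Y), S.hom f →
    ∃ g : Y ⟶ X, S.hom g ∧ Nonempty (Bicategory.Adjunction g f)

/-- `X` is fully dualizable: it belongs to a symmetric monoidal sub-2-category with duals. -/
def IsFullyDualizable (X : Alg₂.{u} k) : Prop :=
  ∃ S : SymmetricMonoidalSub.{u} k, S.HasDuals ∧ S.obj X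

/-- `X` has a dual whose evaluation 1-morphism has a left adjoint and a right adjoint in
`Alg₂(k)`. -/
def HasDualWithAdjointEvaluation (X : Alg₂.{u} k) : Prop :=
  ∃ (Y : Alg₂.{u} k) (ev : tensorObj X Y ⟶ unitObj k) (coev : unitObj k ⟶ tensorObj Y X),
    IsDualPair ev coev ∧
      (∃ g : unitObj k ⟶ tensorObj X Y, Nonempty (Bicategory.Adjunction g ev)) ∧
      (∃ g : unitObj k ⟶ tensorObj X Y, Nonempty (Bicategory.Adjunction ev g))

end Monoidal

end Alg₂

/-!
Both equivalences come from the notion of a *separability element* of an algebra `A`: an element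
`e = ∑ aᵢ ⊗ bᵢ` of `A ⊗ A` with `∑ aᵢ bᵢ = 1` and `∑ a aᵢ ⊗ bᵢ = ∑ aᵢ ⊗ bᵢ a` for all `a`, that is,
a splitting of the multiplication `A ⊗ A → A` as a map of bimodules. Over any field such an element
makes `A` semisimple, by averaging linear projections (`IsSeparabilityElement.isSemisimpleRing`),
and finite-dimensional (`IsSeparabilityElement.moduleFinite`). Conversely, a finite-dimensional
semisimple algebra over `ℂ` is a product of matrix algebras, which have the separability elements
`n⁻¹ ∑ E i j ⊗ E j i`. These are moreover invariant under swapping the factors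
(`IsSymmetricallySeparable`).

Suppose that `A` has a dual `Y`, with evaluation `E` and coevaluation `C`. The composite of the left
zigzag is `E ⊗_Y C` (`zigzagLeft`), and so `E ⊗_Y C ≅ A`. A left adjoint of `E` exhibits `E` as a
finitely generated projective right `A ⊗ Y`-module, hence `A ≅ E ⊗_Y C` as a direct summand of
a sum of copies of `(A ⊗ Y) ⊗_Y C = A ⊗ C`. This gives a separability element
(`exists_isSeparabilityElement`).

In the other direction, the algebras with a symmetric separability element and the
finite-dimensional bimodules between them form a symmetric monoidal sub-2-category `separableSub`
with duals. The opposite algebra is a dual of any algebra (`isDualPair_opObj`). If `M` is a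
finite-dimensional `S`-`R`-bimodule, the linear dual of `M` is both right and left adjoint to `M`:
the unit is given by dual bases, and the counit `x ⊗ φ ↦ ∑ φ (bᵢ x) aᵢ` by a symmetric separability
element of `S` (`DualBases.adjunction`). The roles of `M` and its dual in this construction are
symmetric, so that an element of `R` gives the other adjunction.
-/

/-! ### Separability elements -/

section Separability

variable {k A B : Type*} [Field k] [Ring A] [Algebra k A] [Ring B] [Algebra k B]

/-- `e = ∑ aᵢ ⊗ bᵢ` is a separability element of the `k`-algebra `A`: `∑ aᵢ bᵢ = 1`, and
`∑ a aᵢ ⊗ bᵢ = ∑ aᵢ ⊗ bᵢ a` for all `a`. The products are taken in the algebra `A ⊗ A`. -/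
structure IsSeparabilityElement (e : A ⊗[k] A) : Prop where
  mul'_eq_one : LinearMap.mul' k A e = 1
  tmul_one_mul (a : A) : (a ⊗ₜ 1) * e = e * (1 ⊗ₜ a)

namespace IsSeparabilityElement

variable {e : A ⊗[k] A}

/-- Expand the second factor of `e` in a `k`-basis `x`. The coefficient of `x j` in
`e (1 ⊗ a) = (a ⊗ 1) e` is a left multiple of the coefficient of `x j` in `e`, so only finitely
many `x j` occur for all `a` together, and multiplying out shows that `A` is spanned by finitely
many products. -/
theorem moduleFinite (he : IsSeparabilityElement e) : Module.Finite k A := by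
  classical
  let x := Module.Basis.ofVectorSpace k A
  -- the coefficients, in the left factor, of the second factor
  let φ : A ⊗[k] A ≃ₗ[k] (_ →₀ A) :=
    (LinearEquiv.lTensor A x.repr).trans (TensorProduct.finsuppScalarRight k k A _)
  have hφ : ∀ (a b : A) j, φ (a ⊗ₜ b) j = x.repr b j • a := fun a b j => by simp [φ]
  have hφa : ∀ (a : A) (t : A ⊗[k] A) j, φ ((a ⊗ₜ 1) * t) j = a * φ t j := fun a t j => by
    induction t with
    | zero => simp
    | add s t hs ht => simp only [mul_add, map_add, Finsupp.add_apply, hs, ht]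
    | tmul b c => simp [hφ]
  have hφmul : ∀ t : A ⊗[k] A, LinearMap.mul' k A t = (φ t).sum fun j c => c * x j := fun t => by
    induction t with
    | zero => simp
    | add s t hs ht =>
      rw [map_add, map_add, hs, ht, Finsupp.sum_add_index'] <;> simp [add_mul]
    | tmul b c =>
      have h1 : φ (b ⊗ₜ c) = (x.repr c).mapRange (fun r => r • b) (by simp) := by
        ext j; simp [hφ]
      rw [h1, Finsupp.sum_mapRange_index (by simp), LinearMap.mul'_apply]
      conv_lhs => rw [← x.linearCombination_repr c, Finsupp.linearCombination_apply,
        Finsupp.mul_sum]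
      simp
  obtain ⟨S, hS⟩ := TensorProduct.exists_finset e
  -- `a = ∑ⱼ (coefficient of x j in e (1 ⊗ a)) * x j`, where that coefficient lies in the span
  -- of the first factors of `e`
  let F : Finset A := (S ×ˢ (φ e).support).image fun p => p.1.1 * x p.2
  refine ⟨⟨F, eq_top_iff.2 fun a _ => ?_⟩⟩
  have h1 : a = ∑ j ∈ (φ e).support, φ (e * (1 ⊗ₜ a)) j * x j := by
    have h2 : LinearMap.mul' k A ((a ⊗ₜ 1) * e) = a := by
      have h3 : ∀ t : A ⊗[k] A, LinearMap.mul' k A ((a ⊗ₜ 1) * t) = a * LinearMap.mul' k A t :=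
        fun t => by
          induction t with
          | zero => simp
          | add s t hs ht => simp only [mul_add, map_add, hs, ht]
          | tmul b c => simp [mul_assoc]
      rw [h3, he.mul'_eq_one, mul_one]
    conv_lhs => rw [← h2, hφmul]
    rw [← he.tmul_one_mul]
    refine Finsupp.sum_of_support_subset _ (fun j hj => ?_) _ (by simp)
    rw [Finsupp.mem_support_iff, hφa] at hj
    exact Finsupp.mem_support_iff.2 fun h0 => hj (by rw [h0, mul_zero])
  rw [h1]
  refine Submodule.sum_mem _ fun j hj => ?_
  have h4 : φ (e * (1 ⊗ₜ a)) j = ∑ p ∈ S, x.repr (p.2 * a) j • p.1 := by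
    conv_lhs => rw [hS, Finset.sum_mul, map_sum, Finsupp.finsetSum_apply]
    simp [hφ]
  rw [h4, Finset.sum_mul]
  refine Submodule.sum_mem _ fun p hp => ?_
  rw [smul_mul_assoc]
  exact Submodule.smul_mem _ _ (Submodule.subset_span
    (Finset.mem_coe.2 (Finset.mem_image.2 ⟨(p, j), Finset.mk_mem_product hp hj, rfl⟩)))

/-- A `k`-linear retraction `p` onto a left ideal becomes `A`-linear after averaging:
`x ↦ ∑ aᵢ p (bᵢ x)`. -/
theorem isSemisimpleRing (he : IsSeparabilityElement e) : IsSemisimpleRing A := by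
  refine (isSemisimpleModule_iff A A).2 ⟨fun I => ?_⟩
  obtain ⟨p, hp⟩ := (I.restrictScalars k).subtype.exists_leftInverse_of_injective
    (LinearMap.ker_eq_bot.2 Subtype.val_injective)
  let p' : A →ₗ[k] I := p
  have hp' : ∀ y : I, p' y = y := fun y => LinearMap.congr_fun hp y
  -- `avg x (a ⊗ b) = a • p (b x)`
  let avg : A → A ⊗[k] A →ₗ[k] I := fun x => TensorProduct.lift
    (LinearMap.mk₂ k (fun a b => a • p' (b * x)) (fun a a' b => add_smul _ _ _)
      (fun c a b => smul_assoc _ _ _) (fun a b b' => by simp [add_mul])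
      (fun c a b => by rw [smul_mul_assoc, map_smul, smul_comm]))
  have havg : ∀ x a b, avg x (a ⊗ₜ b) = a • p' (b * x) := fun x a b => rfl
  have h1 : ∀ x y t, avg (x + y) t = avg x t + avg y t := fun x y t => by
    induction t with
    | zero => simp
    | add s t hs ht => rw [map_add, map_add, map_add, hs, ht]; abel
    | tmul a b => simp [havg, mul_add]
  have h2 : ∀ c x t, avg (c * x) t = avg x (t * (1 ⊗ₜ c)) := fun c x t => by
    induction t with
    | zero => simp
    | add s t hs ht => rw [map_add, add_mul, map_add, hs, ht]
    | tmul a b => simp [havg, mul_assoc]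
  have h3 : ∀ c x t, c • avg x t = avg x ((c ⊗ₜ 1) * t) := fun c x t => by
    induction t with
    | zero => simp
    | add s t hs ht => rw [map_add, smul_add, mul_add, map_add, hs, ht]
    | tmul a b => simp [havg, mul_smul]
  have h4 : ∀ (y : I) t, avg y t = LinearMap.mul' k A t • y := fun y t => by
    induction t with
    | zero => simp
    | add s t hs ht => rw [map_add, map_add, add_smul, hs, ht]
    | tmul a b => rw [havg, ← smul_eq_mul, ← I.coe_smul, hp', LinearMap.mul'_apply, mul_smul]
  let q : A →ₗ[A] I :=
    { toFun := fun x => avg x e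
      map_add' := fun x y => h1 x y e
      map_smul' := fun c x => by
        rw [smul_eq_mul, h2, ← he.tmul_one_mul, ← h3, RingHom.id_apply] }
  exact ⟨LinearMap.ker q, LinearMap.isCompl_of_proj (f := q) fun y => by
    change avg y e = y
    rw [h4, he.mul'_eq_one, one_smul]⟩

/-- For a symmetric separability element also `∑ aᵢ ⊗ a bᵢ = ∑ aᵢ a ⊗ bᵢ`. -/
theorem one_tmul_mul (he : IsSeparabilityElement e) (hc : TensorProduct.comm k A A e = e) (a : A) :
    (1 ⊗ₜ a) * e = e * (a ⊗ₜ 1) := by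
  have h := congrArg (Algebra.TensorProduct.comm k A A) (he.tmul_one_mul a)
  have hc' : Algebra.TensorProduct.comm k A A e = e := hc
  simpa [hc'] using h

end IsSeparabilityElement

variable (k A) in
/-- The `k`-algebra `A` has a separability element that is invariant under swapping the factors.
The symmetry makes the linear dual of a bimodule serve as its adjoint on either side. -/
def IsSymmetricallySeparable : Prop :=
  ∃ e : A ⊗[k] A, IsSeparabilityElement e ∧ TensorProduct.comm k A A e = e

namespace IsSymmetricallySeparable

theorem self : IsSymmetricallySeparable k k :=
  ⟨1 ⊗ₜ 1, ⟨by simp, fun a => by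
    have h := TensorProduct.smul_tmul (R := k) a (1 : k) (1 : k)
    simpa using h⟩, by simp⟩

theorem of_algEquiv (φ : A ≃ₐ[k] B) (h : IsSymmetricallySeparable k A) :
    IsSymmetricallySeparable k B := by
  obtain ⟨e, ⟨h1, h2⟩, h3⟩ := h
  let Φ : A ⊗[k] A →ₐ[k] B ⊗[k] B := Algebra.TensorProduct.map φ.toAlgHom φ.toAlgHom
  have hΦ : ∀ t, LinearMap.mul' k B (Φ t) = φ (LinearMap.mul' k A t) := fun t => by
    induction t with
    | zero => simp
    | add s t hs ht => simp only [map_add, hs, ht]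
    | tmul a b => simp [Φ]
  have hΦ' : ∀ t, TensorProduct.comm k B B (Φ t) = Φ (TensorProduct.comm k A A t) := fun t => by
    induction t with
    | zero => simp
    | add s t hs ht => simp only [map_add, hs, ht]
    | tmul a b => simp [Φ]
  refine ⟨Φ e, ⟨by rw [hΦ, h1, map_one], fun b => ?_⟩, by rw [hΦ', h3]⟩
  obtain ⟨a, rfl⟩ := φ.surjective b
  have := congrArg Φ (h2 a)
  simpa [Φ] using this

theorem op (h : IsSymmetricallySeparable k A) : IsSymmetricallySeparable k Aᵐᵒᵖ := by
  obtain ⟨e, ⟨h1, h2⟩, h3⟩ := h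
  let Φ : A ⊗[k] A →ₗ[k] Aᵐᵒᵖ ⊗[k] Aᵐᵒᵖ :=
    TensorProduct.map (opLinearEquiv k).toLinearMap (opLinearEquiv k).toLinearMap
  have hΦ : ∀ t, LinearMap.mul' k Aᵐᵒᵖ (Φ t) =
      MulOpposite.op (LinearMap.mul' k A (TensorProduct.comm k A A t)) := fun t => by
    induction t with
    | zero => simp
    | add s t hs ht => simp only [map_add, hs, ht, MulOpposite.op_add]
    | tmul a b => simp [Φ]
  have hΦ' : ∀ t, TensorProduct.comm k _ _ (Φ t) = Φ (TensorProduct.comm k A A t) := fun t => by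
    induction t with
    | zero => simp
    | add s t hs ht => simp only [map_add, hs, ht]
    | tmul a b => simp [Φ]
  have hl : ∀ a t, (MulOpposite.op a ⊗ₜ 1) * Φ t =
      TensorProduct.comm k _ _ (Φ (TensorProduct.comm k A A t * (1 ⊗ₜ a))) := fun a t => by
    induction t with
    | zero => simp
    | add s t hs ht => simp only [map_add, mul_add, add_mul, hs, ht]
    | tmul b c => simp [Φ]
  have hr : ∀ a t, Φ t * (1 ⊗ₜ MulOpposite.op a) =
      TensorProduct.comm k _ _ (Φ ((a ⊗ₜ 1) * TensorProduct.comm k A A t)) := fun a t => by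
    induction t with
    | zero => simp
    | add s t hs ht => simp only [map_add, mul_add, add_mul, hs, ht]
    | tmul b c => simp [Φ]
  refine ⟨Φ e, ⟨by rw [hΦ, h3, h1, op_one], fun b => ?_⟩, by rw [hΦ', h3]⟩
  obtain ⟨a, rfl⟩ := op_surjective b
  rw [hl, hr, h3, h2]

theorem tensor (hA : IsSymmetricallySeparable k A) (hB : IsSymmetricallySeparable k B) :
    IsSymmetricallySeparable k (A ⊗[k] B) := by
  obtain ⟨e, ⟨e1, e2⟩, e3⟩ := hA
  obtain ⟨f, ⟨f1, f2⟩, f3⟩ := hB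
  let Φ : (A ⊗[k] A) ⊗[k] (B ⊗[k] B) ≃ₐ[k] (A ⊗[k] B) ⊗[k] (A ⊗[k] B) :=
    Algebra.TensorProduct.tensorTensorTensorComm k k k k A A B B
  have hmul : ∀ s t, LinearMap.mul' k (A ⊗[k] B) (Φ (s ⊗ₜ t)) =
      LinearMap.mul' k A s ⊗ₜ LinearMap.mul' k B t := fun s t => by
    induction s with
    | zero => simp
    | add s s' hs hs' => simp only [map_add, add_tmul, hs, hs']
    | tmul a a' =>
      induction t with
      | zero => simp
      | add t t' ht ht' => simp only [map_add, tmul_add, ht, ht']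
      | tmul b b' => simp [Φ]
  have hcomm : ∀ s t, TensorProduct.comm k _ _ (Φ (s ⊗ₜ t)) =
      Φ (TensorProduct.comm k A A s ⊗ₜ TensorProduct.comm k B B t) := fun s t => by
    induction s with
    | zero => simp
    | add s s' hs hs' => simp only [map_add, add_tmul, hs, hs']
    | tmul a a' =>
      induction t with
      | zero => simp
      | add t t' ht ht' => simp only [map_add, tmul_add, ht, ht']
      | tmul b b' => simp [Φ]
  refine ⟨Φ (e ⊗ₜ f), ⟨by rw [hmul, e1, f1]; rfl, fun c => ?_⟩, by rw [hcomm, e3, f3]⟩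
  induction c with
  | zero => simp
  | add c d hc hd => rw [add_tmul, tmul_add, add_mul, mul_add, hc, hd]
  | tmul a b =>
    have h1 : ((a ⊗ₜ[k] b) ⊗ₜ[k] (1 : A ⊗[k] B)) = Φ ((a ⊗ₜ 1) ⊗ₜ (b ⊗ₜ 1)) := by
      simp [Φ, Algebra.TensorProduct.one_def]
    have h2 : ((1 : A ⊗[k] B) ⊗ₜ[k] (a ⊗ₜ[k] b)) = Φ ((1 ⊗ₜ a) ⊗ₜ (1 ⊗ₜ b)) := by
      simp [Φ, Algebra.TensorProduct.one_def]
    rw [h1, h2, ← map_mul, ← map_mul, Algebra.TensorProduct.tmul_mul_tmul,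
      Algebra.TensorProduct.tmul_mul_tmul, e2, f2]

theorem pi {ι : Type*} [Fintype ι] [DecidableEq ι] {A : ι → Type*} [∀ i, Ring (A i)]
    [∀ i, Algebra k (A i)] (h : ∀ i, IsSymmetricallySeparable k (A i)) :
    IsSymmetricallySeparable k (∀ i, A i) := by
  choose e he hc using h
  let s : ∀ i, A i →ₗ[k] ∀ i, A i := LinearMap.single k A
  have hs : ∀ i (x : A i), s i x = Pi.single i x := fun i x => rfl
  let Φ : ∀ i, A i ⊗[k] A i →ₗ[k] (∀ i, A i) ⊗[k] (∀ i, A i) := fun i =>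
    TensorProduct.map (s i) (s i)
  have hmul : ∀ i t, LinearMap.mul' k (∀ i, A i) (Φ i t) = s i (LinearMap.mul' k (A i) t) :=
    fun i t => by
      induction t with
      | zero => simp
      | add s t hs ht => simp only [map_add, hs, ht]
      | tmul a b => simp [Φ, hs, Pi.single_mul]
  have hcomm : ∀ i t, TensorProduct.comm k _ _ (Φ i t) = Φ i (TensorProduct.comm k _ _ t) :=
    fun i t => by
      induction t with
      | zero => simp
      | add s t hs ht => simp only [map_add, hs, ht]
      | tmul a b => simp [Φ]
  have hsl : ∀ (a : ∀ i, A i) i x, a * s i x = s i (a i * x) := fun a i x => by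
    ext j
    rcases eq_or_ne j i with rfl | hj
    · simp [hs]
    · simp [hs, hj]
  have hsr : ∀ (a : ∀ i, A i) i x, s i x * a = s i (x * a i) := fun a i x => by
    ext j
    rcases eq_or_ne j i with rfl | hj
    · simp [hs]
    · simp [hs, hj]
  have hl : ∀ i (a : ∀ i, A i) t, (a ⊗ₜ 1) * Φ i t = Φ i ((a i ⊗ₜ 1) * t) := fun i a t => by
    induction t with
    | zero => simp
    | add s t hs ht => simp only [map_add, mul_add, hs, ht]
    | tmul b c => simp [Φ, hsl]
  have hr : ∀ i (a : ∀ i, A i) t, Φ i t * (1 ⊗ₜ a) = Φ i (t * (1 ⊗ₜ a i)) := fun i a t => by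
    induction t with
    | zero => simp
    | add s t hs ht => simp only [map_add, add_mul, hs, ht]
    | tmul b c => simp [Φ, hsr]
  refine ⟨∑ i, Φ i (e i), ⟨?_, fun a => ?_⟩, by simp [map_sum, hcomm, hc]⟩
  · simp only [map_sum, hmul, (he _).mul'_eq_one]
    exact Finset.univ_sum_single (1 : ∀ i, A i)
  · rw [Finset.mul_sum, Finset.sum_mul]
    exact Finset.sum_congr rfl fun i _ => by rw [hl, hr, (he i).tmul_one_mul]

theorem moduleFinite (h : IsSymmetricallySeparable k A) : Module.Finite k A :=
  have ⟨_, he, _⟩ := h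
  he.moduleFinite

/-- The symmetric separability element `n⁻¹ ∑ E i j ⊗ E j i` of a matrix algebra. -/
theorem matrix [CharZero k] (n : Type*) [Fintype n] [DecidableEq n] :
    IsSymmetricallySeparable k (Matrix n n k) := by
  rcases isEmpty_or_nonempty n with hn | hn
  · -- the algebra is zero
    exact ⟨0, ⟨Subsingleton.elim _ _, fun a => by simp⟩, by simp⟩
  let E : n → n → Matrix n n k := fun i j => Matrix.single i j 1
  have hc : (Fintype.card n : k) ≠ 0 := Nat.cast_ne_zero.2 Fintype.card_ne_zero
  have hE : ∀ i j l m, E i j * E l m = if j = l then E i m else 0 := fun i j l m => by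
    split_ifs with h
    · subst h; simp [E]
    · simp [E, h]
  refine ⟨(Fintype.card n : k)⁻¹ • ∑ i, ∑ j, E i j ⊗ₜ E j i, ⟨?_, fun a => ?_⟩, ?_⟩
  · have h1 : ∑ i, E i i = 1 := by
      ext p q; simp [E, Matrix.sum_apply, Matrix.single_apply, Matrix.one_apply, ite_and]
    simp only [map_smul, map_sum, LinearMap.mul'_apply, hE, if_true]
    rw [Finset.sum_comm]
    simp [h1, ← Nat.cast_smul_eq_nsmul k, smul_smul, hc]
  · rw [mul_smul_comm, smul_mul_assoc]
    congr 1
    have hl : ∀ i j, a * E i j = ∑ p, a p i • E p j := fun i j => by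
      ext p q
      rcases eq_or_ne q j with rfl | hq
      · simp [E, Matrix.sum_apply, Matrix.single_apply]
      · simp [E, Matrix.sum_apply, hq, hq.symm]
    have hr : ∀ i j, E i j * a = ∑ q, a j q • E i q := fun i j => by
      ext p q
      rcases eq_or_ne p i with rfl | hp
      · simp [E, Matrix.sum_apply, Matrix.single_apply]
      · simp [E, Matrix.sum_apply, hp, hp.symm]
    simp only [Finset.mul_sum, Finset.sum_mul, Algebra.TensorProduct.tmul_mul_tmul, hl, hr,
      one_mul, mul_one, TensorProduct.sum_tmul, TensorProduct.tmul_sum,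
      TensorProduct.smul_tmul', TensorProduct.tmul_smul]
    -- both sides are `∑ a p i • (E p j ⊗ E j i)`
    calc _ = ∑ i, ∑ p, ∑ j, a p i • (E p j ⊗ₜ[k] E j i) :=
          Finset.sum_congr rfl fun i _ => Finset.sum_comm
      _ = ∑ p, ∑ i, ∑ j, a p i • (E p j ⊗ₜ[k] E j i) := Finset.sum_comm
      _ = _ := Finset.sum_congr rfl fun p _ => Finset.sum_comm
  · simp only [map_smul, map_sum, TensorProduct.comm_tmul]
    rw [Finset.sum_comm]

end IsSymmetricallySeparable

end Separability

theorem IsSemisimpleRing.isSymmetricallySeparable (k A : Type*) [Field k] [IsAlgClosed k]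
    [CharZero k] [Ring A] [Algebra k A] [IsSemisimpleRing A] [Module.Finite k A] :
    IsSymmetricallySeparable k A := by
  obtain ⟨n, d, _, ⟨φ⟩⟩ := IsSemisimpleRing.exists_algEquiv_pi_matrix_of_isAlgClosed k A
  exact .of_algEquiv φ.symm (.pi fun _ => .matrix _)

namespace Alg₂

variable {k : Type} [Field k]

/-! ### Restriction of bimodules along algebra homomorphisms -/

section Restrict

variable {A A' B B' C D : Alg₂.{u} k}

/-- The bimodule `M`, with left action restricted along `ψ` and right action restricted along
`φ`. -/
def restrict (ψ : B' →ₐ[k] B) (φ : A →ₐ[k] A') (M : Bimodule A' B) : Bimodule A B' where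
  carrier := M
  left := M.left.comp ψ
  right := M.right.comp (AlgHom.op φ)
  comm _ _ m := M.comm _ _ m

/-- An element of `M`, seen in a restriction of `M`. -/
def restrictElt (ψ : B' →ₐ[k] B) (φ : A →ₐ[k] A') (M : Bimodule A' B) :
    M ≃ₗ[k] restrict ψ φ M := LinearEquiv.refl k M

@[simp]
theorem restrict_left (ψ : B' →ₐ[k] B) (φ : A →ₐ[k] A') (M : Bimodule A' B) (b : B') (m : M) :
    (restrict ψ φ M).left b (restrictElt ψ φ M m) = restrictElt ψ φ M (M.left (ψ b) m) := rfl

@[simp]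
theorem restrict_right (ψ : B' →ₐ[k] B) (φ : A →ₐ[k] A') (M : Bimodule A' B) (a : A) (m : M) :
    (restrict ψ φ M).right (op a) (restrictElt ψ φ M m) =
      restrictElt ψ φ M (M.right (op (φ a)) m) := rfl

/-- `m ↦ x ↦ m x`. -/
def ofAlgHomRightBil (φ : A →ₐ[k] A') (M : Bimodule A' B) :
    M →ₗ[k] ofAlgHom φ →ₗ[k] restrict (.id k B) φ M :=
  (LinearMap.flip (M.right.toLinearMap ∘ₗ (opLinearEquiv k).toLinearMap ∘ₗ
    (elt φ).symm.toLinearMap)).compr₂ (restrictElt _ φ M).toLinearMap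

@[simp]
theorem ofAlgHomRightBil_apply (φ : A →ₐ[k] A') (M : Bimodule A' B) (m : M) (x : A') :
    ofAlgHomRightBil φ M m (elt φ x) = restrictElt _ φ M (M.right (op x) m) := (rfl)

/-- `M ⊗ A' ≅ M` over `A'`, where `A` acts on the right through `φ : A → A'`. -/
def ofAlgHomRight (φ : A →ₐ[k] A') (M : Bimodule A' B) :
    tensorOver M (ofAlgHom φ) ≅ restrict (.id k B) φ M :=
  mkIso
    (tdesc (ofAlgHomRightBil φ M)
      (fun y s x => by
        obtain ⟨x, rfl⟩ := (elt φ).surjective x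
        simp)
      (fun t y x => by
        obtain ⟨x, rfl⟩ := (elt φ).surjective x
        simp [M.comm])
      (fun r y x => by
        obtain ⟨x, rfl⟩ := (elt φ).surjective x
        obtain ⟨r, rfl⟩ := op_surjective r
        simp))
    ((tmk M (ofAlgHom φ)).flip (elt φ 1) ∘ₗ (restrictElt _ φ M).symm.toLinearMap)
    (tmk_ext fun y x => by
      obtain ⟨x, rfl⟩ := (elt φ).surjective x
      simp [tmk_smul])
    (LinearMap.ext fun y => by
      obtain ⟨y, rfl⟩ := (restrictElt _ φ M).surjective y
      simp)

/-- `d ↦ m ↦ ψ⁻¹(d) m`. -/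
def ofAlgEquivLeftBil (ψ : B ≃ₐ[k] C) (M : Bimodule A B) :
    ofAlgHom ψ.toAlgHom →ₗ[k] M →ₗ[k] restrict ψ.symm.toAlgHom (.id k A) M :=
  (M.left.toLinearMap ∘ₗ ψ.symm.toLinearMap ∘ₗ (elt ψ.toAlgHom).symm.toLinearMap).compr₂
    (restrictElt _ _ M).toLinearMap

@[simp]
theorem ofAlgEquivLeftBil_apply (ψ : B ≃ₐ[k] C) (M : Bimodule A B) (x : C) (m : M) :
    ofAlgEquivLeftBil ψ M (elt ψ.toAlgHom x) m = restrictElt _ _ M (M.left (ψ.symm x) m) := (rfl)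

/-- `C ⊗_B M ≅ M`, where `C` acts through an isomorphism `ψ : B ≃ C`. -/
def ofAlgEquivLeft (ψ : B ≃ₐ[k] C) (M : Bimodule A B) :
    tensorOver (ofAlgHom ψ.toAlgHom) M ≅ restrict ψ.symm.toAlgHom (.id k A) M :=
  mkIso
    (tdesc (ofAlgEquivLeftBil ψ M)
      (fun y s x => by
        obtain ⟨y, rfl⟩ := (elt ψ.toAlgHom).surjective y
        simp)
      (fun t y x => by
        obtain ⟨y, rfl⟩ := (elt ψ.toAlgHom).surjective y
        simp)
      (fun r y x => by
        obtain ⟨y, rfl⟩ := (elt ψ.toAlgHom).surjective y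
        obtain ⟨r, rfl⟩ := op_surjective r
        simp [M.comm]))
    (tmk (ofAlgHom ψ.toAlgHom) M (elt ψ.toAlgHom 1) ∘ₗ (restrictElt _ _ M).symm.toLinearMap)
    (tmk_ext fun y x => by
      obtain ⟨y, rfl⟩ := (elt ψ.toAlgHom).surjective y
      simp [← tmk_smul])
    (LinearMap.ext fun y => by
      obtain ⟨y, rfl⟩ := (restrictElt _ _ M).surjective y
      simp)

/-- A composite of the shape of a zigzag, with the 1-morphisms of algebra isomorphisms absorbed
into the actions. -/
def zigzagIso {F : Alg₂.{u} k} (φ : A →ₐ[k] A') (M : A' ⟶ B) (ψ : B →ₐ[k] C) (N : C ⟶ D)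
    (χ : D ≃ₐ[k] F) :
    homOf φ ≫ M ≫ homOf ψ ≫ N ≫ homOf χ.toAlgHom ≅
      tensorOver (restrict (.id k F) ψ (restrict χ.symm.toAlgHom (.id k C) N))
        (restrict (.id k B) φ M) :=
  (Bicategory.associator (homOf φ) M _).symm ≪≫
    Bicategory.whiskerRightIso (ofAlgHomRight φ M) _ ≪≫
    Bicategory.whiskerLeftIso (a := A) (b := B) (restrict (.id k B) φ M)
      (Bicategory.whiskerLeftIso (homOf ψ) (ofAlgEquivLeft χ N) ≪≫ ofAlgHomRight ψ _)

end Restrict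

/-! ### Pure tensors in a tensor product of algebras -/

section TensorObj

variable {X Y : Alg₂.{u} k}

/-- The pure tensor `x ⊗ y`, as a bilinear map. Unlike `x ⊗ₜ y`, it has the type
`tensorObj X Y`, so that the bimodule actions apply to it. -/
def ptmul (X Y : Alg₂.{u} k) : X →ₗ[k] Y →ₗ[k] tensorObj X Y := TensorProduct.mk k X Y

theorem ptmul_mul (x x' : X) (y y' : Y) :
    ptmul X Y x y * ptmul X Y x' y' = ptmul X Y (x * x') (y * y') :=
  Algebra.TensorProduct.tmul_mul_tmul x x' y y'

@[simp]
theorem left_ptmul_one {R : Alg₂.{u} k} (M : Bimodule R (tensorObj X Y)) (m : M) :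
    M.left (ptmul X Y 1 1) m = m :=
  LinearMap.congr_fun (map_one M.left) m

@[simp]
theorem right_ptmul_one {R : Alg₂.{u} k} (M : Bimodule (tensorObj X Y) R) (m : M) :
    M.right (op (ptmul X Y 1 1)) m = m :=
  LinearMap.congr_fun (map_one M.right) m

theorem left_ptmul_ptmul {R : Alg₂.{u} k} (M : Bimodule R (tensorObj X Y)) (x x' : X) (y y' : Y)
    (m : M) : M.left (ptmul X Y x y) (M.left (ptmul X Y x' y') m) =
      M.left (ptmul X Y (x * x') (y * y')) m := by
  rw [← ptmul_mul, map_mul, Module.End.mul_apply]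

theorem right_ptmul_ptmul {R : Alg₂.{u} k} (M : Bimodule (tensorObj X Y) R) (x x' : X) (y y' : Y)
    (m : M) : M.right (op (ptmul X Y x y)) (M.right (op (ptmul X Y x' y')) m) =
      M.right (op (ptmul X Y (x' * x) (y' * y))) m := by
  rw [← ptmul_mul, op_mul, map_mul, Module.End.mul_apply]

theorem ptmul_induction {p : tensorObj X Y → Prop} (zero : p 0)
    (ptmul : ∀ x y, p (ptmul X Y x y)) (add : ∀ s t, p s → p t → p (s + t)) (t : tensorObj X Y) :
    p t :=
  TensorProduct.induction_on (motive := p) t zero ptmul add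

end TensorObj

/-! ### The left zigzag composite -/

section ZigzagLeft

variable {X Y : Alg₂.{u} k} (E : Bimodule (tensorObj X Y) (unitObj k))
  (C : Bimodule (unitObj k) (tensorObj Y X))

/-- `E ⊗ X`, as an `X`-`X ⊗ (Y ⊗ X)`-bimodule. -/
def evTensor : Bimodule (tensorObj X (tensorObj Y X)) X :=
  restrict (.id k X) (assocEquiv X Y X).symm.toAlgHom
    (restrict (leftUnitEquiv X).symm.toAlgHom (.id k _)
      (tensorHom (A := tensorObj X Y) (B := unitObj k) E (𝟙 X)))

/-- `X ⊗ C`, as an `X ⊗ (Y ⊗ X)`-`X`-bimodule. -/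
def tensorCoev : Bimodule X (tensorObj X (tensorObj Y X)) :=
  restrict (.id k _) (rightUnitEquiv X).symm.toAlgHom
    (tensorHom (C := unitObj k) (D := tensorObj Y X) (𝟙 X) C)

/-- An element of `E ⊗ X`, seen in `evTensor E`. -/
def evTensorElt : E ⊗[k] X ≃ₗ[k] evTensor E := LinearEquiv.refl k _

/-- An element of `X ⊗ C`, seen in `tensorCoev C`. -/
def tensorCoevElt : X ⊗[k] C ≃ₗ[k] tensorCoev C := LinearEquiv.refl k _

@[simp]
theorem evTensor_left (a : X) (e : E) (x : X) :
    (evTensor E).left a (evTensorElt E (e ⊗ₜ x)) = evTensorElt E (e ⊗ₜ (a * x)) :=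
  (tensorLeft_tmul E (idBimodule X) 1 a e x).trans (by rw [map_one]; rfl)

@[simp]
theorem evTensor_right (a : X) (y : Y) (b : X) (e : E) (x : X) :
    (evTensor E).right (op (ptmul _ _ a (ptmul _ _ y b))) (evTensorElt E (e ⊗ₜ x)) =
      evTensorElt E (E.right (op (ptmul _ _ a y)) e ⊗ₜ (x * b)) :=
  tensorRight_tmul E (idBimodule X) (a ⊗ₜ y) b e x

@[simp]
theorem tensorCoev_left (a : X) (y : Y) (b : X) (x : X) (c : C) :
    (tensorCoev C).left (ptmul _ _ a (ptmul _ _ y b)) (tensorCoevElt C (x ⊗ₜ c)) =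
      tensorCoevElt C ((a * x) ⊗ₜ C.left (ptmul _ _ y b) c) :=
  tensorLeft_tmul (idBimodule X) C a (y ⊗ₜ b) x c

@[simp]
theorem tensorCoev_right (a : X) (x : X) (c : C) :
    (tensorCoev C).right (op a) (tensorCoevElt C (x ⊗ₜ c)) = tensorCoevElt C ((x * a) ⊗ₜ c) :=
  (tensorRight_tmul (idBimodule X) C a 1 x c).trans (by rw [op_one, map_one]; rfl)

/-- The composite of the left zigzag of `E` and `C`, which is `E ⊗_Y C`. -/
abbrev zigzagLeft : Bimodule X X := tensorOver (evTensor E) (tensorCoev C)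

/-- The composite 1-morphism in the left zigzag equation is `zigzagLeft E C`. -/
def zigzagLeftIso :
    (homOf (rightUnitEquiv X).symm.toAlgHom ≫
      tensorHom (C := unitObj k) (D := tensorObj Y X) (𝟙 X) C ≫
      homOf (assocEquiv X Y X).symm.toAlgHom ≫
      tensorHom (A := tensorObj X Y) (B := unitObj k) E (𝟙 X) ≫
      homOf (leftUnitEquiv X).toAlgHom) ≅ zigzagLeft E C :=
  zigzagIso _ _ _ _ _

/-- The pure tensor `e ⊗ c` in `E ⊗_Y C`. -/
def zmkLeft : E →ₗ[k] C →ₗ[k] zigzagLeft E C :=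
  (tmk (evTensor E) (tensorCoev C)).compl₁₂
    ((evTensorElt E).toLinearMap ∘ₗ (TensorProduct.mk k E X).flip 1)
    ((tensorCoevElt C).toLinearMap ∘ₗ TensorProduct.mk k X C 1)

variable {E C}

theorem zmkLeft_apply (e : E) (c : C) : zmkLeft E C e c =
    tmk (evTensor E) (tensorCoev C) (evTensorElt E (e ⊗ₜ 1)) (tensorCoevElt C (1 ⊗ₜ c)) := rfl

/-- `(e ⊗ x) ⊗ (x' ⊗ c) = e x' ⊗ x c`, so `E ⊗_Y C` is spanned by the pure tensors `e ⊗ c`. -/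
theorem tmk_evTensorElt_tensorCoevElt (e : E) (x x' : X) (c : C) :
    tmk (evTensor E) (tensorCoev C) (evTensorElt E (e ⊗ₜ x)) (tensorCoevElt C (x' ⊗ₜ c)) =
      zmkLeft E C (E.right (op (ptmul _ _ x' 1)) e) (C.left (ptmul _ _ 1 x) c) := by
  -- move `x'` over to the left factor, then `x` to the right factor
  have h₁ := tmk_smul (evTensor E) (tensorCoev C) (evTensorElt E (e ⊗ₜ x))
    (ptmul _ _ x' (ptmul _ _ 1 1)) (tensorCoevElt C (1 ⊗ₜ c))
  have h₂ := tmk_smul (evTensor E) (tensorCoev C)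
    (evTensorElt E (E.right (op (ptmul _ _ x' 1)) e ⊗ₜ 1)) (ptmul _ _ 1 (ptmul _ _ 1 x))
    (tensorCoevElt C (1 ⊗ₜ c))
  simp only [evTensor_right, tensorCoev_left, mul_one, one_mul, left_ptmul_one,
    right_ptmul_one] at h₁ h₂
  rw [zmkLeft_apply, ← h₁, h₂]

theorem zmkLeft_balanced (e : E) (y : Y) (c : C) :
    zmkLeft E C (E.right (op (ptmul _ _ 1 y)) e) c =
      zmkLeft E C e (C.left (ptmul _ _ y 1) c) := by
  have h := tmk_smul (evTensor E) (tensorCoev C) (evTensorElt E (e ⊗ₜ 1))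
    (ptmul _ _ 1 (ptmul _ _ y 1)) (tensorCoevElt C (1 ⊗ₜ c))
  simpa only [evTensor_right, tensorCoev_left, mul_one, ← zmkLeft_apply] using h

theorem zigzagLeft_left (a : X) (e : E) (c : C) :
    (zigzagLeft E C).left a (zmkLeft E C e c) = zmkLeft E C e (C.left (ptmul _ _ 1 a) c) := by
  rw [zmkLeft_apply, tensorOver_left, evTensor_left, tmk_evTensorElt_tensorCoevElt,
    right_ptmul_one, mul_one]

theorem zigzagLeft_right (a : X) (e : E) (c : C) :
    (zigzagLeft E C).right (op a) (zmkLeft E C e c) =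
      zmkLeft E C (E.right (op (ptmul _ _ a 1)) e) c := by
  rw [zmkLeft_apply, tensorOver_right, tensorCoev_right, tmk_evTensorElt_tensorCoevElt,
    left_ptmul_one, one_mul]

theorem zmkLeft_ext {P : Type*} [AddCommGroup P] [Module k P] {f g : zigzagLeft E C →ₗ[k] P}
    (h : ∀ e c, f (zmkLeft E C e c) = g (zmkLeft E C e c)) : f = g := by
  refine tmk_ext fun y x => ?_
  obtain ⟨y, rfl⟩ := (evTensorElt E).surjective y
  obtain ⟨x, rfl⟩ := (tensorCoevElt C).surjective x
  induction y with
  | zero => simp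
  | add y y' hy hy' => simp only [map_add, LinearMap.add_apply, hy, hy']
  | tmul e a =>
    induction x with
    | zero => simp
    | add x x' hx hx' => simp only [map_add, hx, hx']
    | tmul b c => rw [tmk_evTensorElt_tensorCoevElt]; exact h _ _

section Lift

variable {P : Type*} [AddCommGroup P] [Module k P] (f : E →ₗ[k] C →ₗ[k] P)

/-- `(e ⊗ x) ↦ (x' ⊗ c) ↦ f (e x') (x c)`. -/
def zliftLeftBil : evTensor E →ₗ[k] tensorCoev C →ₗ[k] P :=
  (TensorProduct.curry (TensorProduct.lift f ∘ₗ
    TensorProduct.map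
      (TensorProduct.lift (E.right.toLinearMap ∘ₗ (opLinearEquiv k).toLinearMap ∘ₗ
        (ptmul X Y).flip 1).flip)
      (TensorProduct.lift (C.left.toLinearMap ∘ₗ ptmul Y X 1)) ∘ₗ
    (TensorProduct.tensorTensorTensorComm k E X X C).toLinearMap)).compl₁₂
      (evTensorElt E).symm.toLinearMap (tensorCoevElt C).symm.toLinearMap

theorem zliftLeftBil_apply (e : E) (x x' : X) (c : C) :
    zliftLeftBil f (evTensorElt E (e ⊗ₜ x)) (tensorCoevElt C (x' ⊗ₜ c)) =
      f (E.right (op (ptmul _ _ x' 1)) e) (C.left (ptmul _ _ 1 x) c) := by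
  simp [zliftLeftBil]

/-- The linear map out of `E ⊗_Y C` given by a `Y`-balanced bilinear map. -/
def zliftLeft
    (h : ∀ e y c, f (E.right (op (ptmul _ _ 1 y)) e) c = f e (C.left (ptmul _ _ y 1) c)) :
    zigzagLeft E C →ₗ[k] P :=
  tlift (zliftLeftBil f) fun e s c => by
    obtain ⟨e, rfl⟩ := (evTensorElt E).surjective e
    obtain ⟨c, rfl⟩ := (tensorCoevElt C).surjective c
    induction e with
    | zero => simp
    | add e e' he he' => simp only [map_add, LinearMap.add_apply, he, he']
    | tmul e x =>
      induction c with
      | zero => simp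
      | add c c' hc hc' => simp only [map_add, hc, hc']
      | tmul x' c =>
        induction s using ptmul_induction with
        | zero => simp
        | add s t hs ht => simp only [map_add, MulOpposite.op_add, LinearMap.add_apply, hs, ht]
        | ptmul a s =>
          induction s using ptmul_induction with
          | zero => simp
          | add s t hs ht => simp only [map_add, MulOpposite.op_add, LinearMap.add_apply, hs, ht]
          | ptmul y b =>
            rw [evTensor_right, tensorCoev_left, zliftLeftBil_apply, zliftLeftBil_apply]
            have h₁ := h (E.right (op (ptmul _ _ (a * x') 1)) e) y (C.left (ptmul _ _ 1 (x * b)) c)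
            simpa [left_ptmul_ptmul, right_ptmul_ptmul, mul_assoc] using h₁

@[simp]
theorem zliftLeft_zmkLeft
    (h : ∀ e y c, f (E.right (op (ptmul _ _ 1 y)) e) c = f e (C.left (ptmul _ _ y 1) c))
    (e : E) (c : C) : zliftLeft f h (zmkLeft E C e c) = f e c := by
  rw [zliftLeft, zmkLeft_apply, tlift_tmk, zliftLeftBil_apply]
  simp

end Lift

end ZigzagLeft

/-! ### The right zigzag composite -/

section ZigzagRight

variable {X Y : Alg₂.{u} k} (E : Bimodule (tensorObj X Y) (unitObj k))
  (C : Bimodule (unitObj k) (tensorObj Y X))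

/-- `Y ⊗ E`, as a `Y`-`(Y ⊗ X) ⊗ Y`-bimodule. -/
def tensorEv : Bimodule (tensorObj (tensorObj Y X) Y) Y :=
  restrict (.id k Y) (assocEquiv Y X Y).toAlgHom
    (restrict (rightUnitEquiv Y).symm.toAlgHom (.id k _)
      (tensorHom (C := tensorObj X Y) (D := unitObj k) (𝟙 Y) E))

/-- `C ⊗ Y`, as a `(Y ⊗ X) ⊗ Y`-`Y`-bimodule. -/
def coevTensor : Bimodule Y (tensorObj (tensorObj Y X) Y) :=
  restrict (.id k _) (leftUnitEquiv Y).symm.toAlgHom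
    (tensorHom (A := unitObj k) (B := tensorObj Y X) C (𝟙 Y))

/-- An element of `Y ⊗ E`, seen in `tensorEv E`. -/
def tensorEvElt : Y ⊗[k] E ≃ₗ[k] tensorEv E := LinearEquiv.refl k _

/-- An element of `C ⊗ Y`, seen in `coevTensor C`. -/
def coevTensorElt : C ⊗[k] Y ≃ₗ[k] coevTensor C := LinearEquiv.refl k _

@[simp]
theorem tensorEv_left (a : Y) (e : E) (y : Y) :
    (tensorEv E).left a (tensorEvElt E (y ⊗ₜ e)) = tensorEvElt E ((a * y) ⊗ₜ e) :=
  (tensorLeft_tmul (idBimodule Y) E a 1 y e).trans (by rw [map_one]; rfl)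

@[simp]
theorem tensorEv_right (a : Y) (x : X) (b : Y) (e : E) (y : Y) :
    (tensorEv E).right (op (ptmul _ _ (ptmul _ _ a x) b)) (tensorEvElt E (y ⊗ₜ e)) =
      tensorEvElt E ((y * a) ⊗ₜ E.right (op (ptmul _ _ x b)) e) :=
  tensorRight_tmul (idBimodule Y) E a (x ⊗ₜ b) y e

@[simp]
theorem coevTensor_left (a : Y) (x : X) (b : Y) (y : Y) (c : C) :
    (coevTensor C).left (ptmul _ _ (ptmul _ _ a x) b) (coevTensorElt C (c ⊗ₜ y)) =
      coevTensorElt C (C.left (ptmul _ _ a x) c ⊗ₜ (b * y)) :=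
  tensorLeft_tmul C (idBimodule Y) (a ⊗ₜ x) b c y

@[simp]
theorem coevTensor_right (a : Y) (y : Y) (c : C) :
    (coevTensor C).right (op a) (coevTensorElt C (c ⊗ₜ y)) = coevTensorElt C (c ⊗ₜ (y * a)) :=
  (tensorRight_tmul C (idBimodule Y) 1 a c y).trans (by rw [op_one, map_one]; rfl)

/-- The composite of the right zigzag of `E` and `C`, which is `E ⊗_X C`. -/
abbrev zigzagRight : Bimodule Y Y := tensorOver (tensorEv E) (coevTensor C)

/-- The composite 1-morphism in the right zigzag equation is `zigzagRight E C`. -/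
def zigzagRightIso :
    (homOf (leftUnitEquiv Y).symm.toAlgHom ≫
      tensorHom (A := unitObj k) (B := tensorObj Y X) C (𝟙 Y) ≫
      homOf (assocEquiv Y X Y).toAlgHom ≫
      tensorHom (C := tensorObj X Y) (D := unitObj k) (𝟙 Y) E ≫
      homOf (rightUnitEquiv Y).toAlgHom) ≅ zigzagRight E C :=
  zigzagIso _ _ _ _ _

/-- The pure tensor `e ⊗ c` in `E ⊗_X C`. -/
def zmkRight : E →ₗ[k] C →ₗ[k] zigzagRight E C :=
  (tmk (tensorEv E) (coevTensor C)).compl₁₂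
    ((tensorEvElt E).toLinearMap ∘ₗ TensorProduct.mk k Y E 1)
    ((coevTensorElt C).toLinearMap ∘ₗ (TensorProduct.mk k C Y).flip 1)

variable {E C}

theorem zmkRight_apply (e : E) (c : C) : zmkRight E C e c =
    tmk (tensorEv E) (coevTensor C) (tensorEvElt E (1 ⊗ₜ e)) (coevTensorElt C (c ⊗ₜ 1)) := rfl

/-- `(y ⊗ e) ⊗ (c ⊗ y') = e y' ⊗ y c`, so `E ⊗_X C` is spanned by the pure tensors `e ⊗ c`. -/
theorem tmk_tensorEvElt_coevTensorElt (e : E) (y y' : Y) (c : C) :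
    tmk (tensorEv E) (coevTensor C) (tensorEvElt E (y ⊗ₜ e)) (coevTensorElt C (c ⊗ₜ y')) =
      zmkRight E C (E.right (op (ptmul _ _ 1 y')) e) (C.left (ptmul _ _ y 1) c) := by
  -- move `y'` over to the left factor, then `y` to the right factor
  have h₁ := tmk_smul (tensorEv E) (coevTensor C) (tensorEvElt E (y ⊗ₜ e))
    (ptmul _ _ (ptmul _ _ 1 1) y') (coevTensorElt C (c ⊗ₜ 1))
  have h₂ := tmk_smul (tensorEv E) (coevTensor C)
    (tensorEvElt E (1 ⊗ₜ E.right (op (ptmul _ _ 1 y')) e)) (ptmul _ _ (ptmul _ _ y 1) 1)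
    (coevTensorElt C (c ⊗ₜ 1))
  simp only [tensorEv_right, coevTensor_left, mul_one, one_mul, left_ptmul_one,
    right_ptmul_one] at h₁ h₂
  rw [zmkRight_apply, ← h₁, h₂]

theorem zmkRight_balanced (e : E) (x : X) (c : C) :
    zmkRight E C (E.right (op (ptmul _ _ x 1)) e) c =
      zmkRight E C e (C.left (ptmul _ _ 1 x) c) := by
  have h := tmk_smul (tensorEv E) (coevTensor C) (tensorEvElt E (1 ⊗ₜ e))
    (ptmul _ _ (ptmul _ _ 1 x) 1) (coevTensorElt C (c ⊗ₜ 1))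
  simpa only [tensorEv_right, coevTensor_left, mul_one, ← zmkRight_apply] using h

theorem zigzagRight_left (a : Y) (e : E) (c : C) :
    (zigzagRight E C).left a (zmkRight E C e c) = zmkRight E C e (C.left (ptmul _ _ a 1) c) := by
  rw [zmkRight_apply, tensorOver_left, tensorEv_left, tmk_tensorEvElt_coevTensorElt,
    right_ptmul_one, mul_one]

theorem zigzagRight_right (a : Y) (e : E) (c : C) :
    (zigzagRight E C).right (op a) (zmkRight E C e c) =
      zmkRight E C (E.right (op (ptmul _ _ 1 a)) e) c := by
  rw [zmkRight_apply, tensorOver_right, coevTensor_right, tmk_tensorEvElt_coevTensorElt,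
    left_ptmul_one, one_mul]

theorem zmkRight_ext {P : Type*} [AddCommGroup P] [Module k P] {f g : zigzagRight E C →ₗ[k] P}
    (h : ∀ e c, f (zmkRight E C e c) = g (zmkRight E C e c)) : f = g := by
  refine tmk_ext fun y x => ?_
  obtain ⟨y, rfl⟩ := (tensorEvElt E).surjective y
  obtain ⟨x, rfl⟩ := (coevTensorElt C).surjective x
  induction y with
  | zero => simp
  | add y y' hy hy' => simp only [map_add, LinearMap.add_apply, hy, hy']
  | tmul a e =>
    induction x with
    | zero => simp
    | add x x' hx hx' => simp only [map_add, hx, hx']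
    | tmul c b => rw [tmk_tensorEvElt_coevTensorElt]; exact h _ _

section Lift

variable {P : Type*} [AddCommGroup P] [Module k P] (f : E →ₗ[k] C →ₗ[k] P)

/-- `(y ⊗ e) ↦ (c ⊗ y') ↦ f (e y') (y c)`. -/
def zliftRightBil : tensorEv E →ₗ[k] coevTensor C →ₗ[k] P :=
  (TensorProduct.curry (TensorProduct.lift f ∘ₗ
    TensorProduct.map
      (TensorProduct.lift (E.right.toLinearMap ∘ₗ (opLinearEquiv k).toLinearMap ∘ₗ
        ptmul X Y 1).flip)
      (TensorProduct.lift (C.left.toLinearMap ∘ₗ (ptmul Y X).flip 1)) ∘ₗ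
    (TensorProduct.tensorTensorTensorComm k E Y Y C).toLinearMap)).compl₁₂
      ((TensorProduct.comm k Y E).toLinearMap ∘ₗ (tensorEvElt E).symm.toLinearMap)
      ((TensorProduct.comm k C Y).toLinearMap ∘ₗ (coevTensorElt C).symm.toLinearMap)

theorem zliftRightBil_apply (e : E) (y y' : Y) (c : C) :
    zliftRightBil f (tensorEvElt E (y ⊗ₜ e)) (coevTensorElt C (c ⊗ₜ y')) =
      f (E.right (op (ptmul _ _ 1 y')) e) (C.left (ptmul _ _ y 1) c) := by
  simp [zliftRightBil]

/-- The linear map out of `E ⊗_X C` given by an `X`-balanced bilinear map. -/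
def zliftRight
    (h : ∀ e x c, f (E.right (op (ptmul _ _ x 1)) e) c = f e (C.left (ptmul _ _ 1 x) c)) :
    zigzagRight E C →ₗ[k] P :=
  tlift (zliftRightBil f) fun e s c => by
    obtain ⟨e, rfl⟩ := (tensorEvElt E).surjective e
    obtain ⟨c, rfl⟩ := (coevTensorElt C).surjective c
    induction e with
    | zero => simp
    | add e e' he he' => simp only [map_add, LinearMap.add_apply, he, he']
    | tmul y e =>
      induction c with
      | zero => simp
      | add c c' hc hc' => simp only [map_add, hc, hc']
      | tmul c y' =>
        induction s using ptmul_induction with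
        | zero => simp
        | add s t hs ht => simp only [map_add, MulOpposite.op_add, LinearMap.add_apply, hs, ht]
        | ptmul s a =>
          induction s using ptmul_induction with
          | zero => simp
          | add s t hs ht => simp only [map_add, MulOpposite.op_add, LinearMap.add_apply, hs, ht]
          | ptmul b x =>
            rw [tensorEv_right, coevTensor_left, zliftRightBil_apply, zliftRightBil_apply]
            have h₁ := h (E.right (op (ptmul _ _ 1 (a * y'))) e) x (C.left (ptmul _ _ (y * b) 1) c)
            simpa [left_ptmul_ptmul, right_ptmul_ptmul, mul_assoc] using h₁

@[simp]
theorem zliftRight_zmkRight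
    (h : ∀ e x c, f (E.right (op (ptmul _ _ x 1)) e) c = f e (C.left (ptmul _ _ 1 x) c))
    (e : E) (c : C) : zliftRight f h (zmkRight E C e c) = f e c := by
  rw [zliftRight, zmkRight_apply, tlift_tmk, zliftRightBil_apply]
  simp

end Lift

end ZigzagRight

/-! ### The opposite algebra is a dual -/

section Dual

/-- The opposite algebra. -/
def opObj (X : Alg₂.{u} k) : Alg₂.{u} k := of Xᵐᵒᵖ

/-- An element of `X`, seen in the opposite algebra. -/
def opElt (X : Alg₂.{u} k) : X ≃ₗ[k] opObj X := opLinearEquiv k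

theorem opElt_one (X : Alg₂.{u} k) : opElt X 1 = 1 := rfl

theorem opElt_mul {X : Alg₂.{u} k} (a b : X) : opElt X a * opElt X b = opElt X (b * a) := rfl

variable (X : Alg₂.{u} k)

/-- The algebra `X` as a right `X ⊗ Xᵐᵒᵖ`-module, with `e (a ⊗ op b) = b e a`. -/
def evBimodule : Bimodule (tensorObj X (opObj X)) (unitObj k) where
  carrier := X
  left := (Algebra.ofId k (Module.End k X)).comp
    (ULift.algEquiv (R := k) (A := k) : ULift.{u} k ≃ₐ[k] k).toAlgHom
  right := (Algebra.TensorProduct.lift (Algebra.lsmul k k X)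
    ((Algebra.lsmul k k X).comp (AlgEquiv.opOp k X).symm.toAlgHom) (fun a b => by
      ext x
      simp [mul_assoc])).comp
        (Algebra.TensorProduct.opAlgEquiv k k X Xᵐᵒᵖ).symm.toAlgHom
  comm s _ m := (LinearMap.map_smul _ (ULift.down s) m).symm

/-- The algebra `X` as a left `Xᵐᵒᵖ ⊗ X`-module, with `(op b ⊗ a) c = a c b`. -/
def coevBimodule : Bimodule (unitObj k) (tensorObj (opObj X) X) where
  carrier := X
  left := Algebra.TensorProduct.lift (Algebra.lsmul k k X : Xᵐᵒᵖ →ₐ[k] Module.End k X)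
    (Algebra.lsmul k k X) (fun a b => by
      ext x
      exact mul_assoc b x (unop a))
  right := ((Algebra.ofId k (Module.End k X)).comp
    (ULift.algEquiv (R := k) (A := k) : ULift.{u} k ≃ₐ[k] k).toAlgHom).comp
      (AlgEquiv.toOpposite k (ULift.{u} k)).symm.toAlgHom
  comm _ r m := LinearMap.map_smul _ (ULift.down (unop r)) m

/-- An element of `X`, seen in `evBimodule X`. -/
def evBimoduleElt : X ≃ₗ[k] evBimodule X := LinearEquiv.refl k X

/-- An element of `X`, seen in `coevBimodule X`. -/
def coevBimoduleElt : X ≃ₗ[k] coevBimodule X := LinearEquiv.refl k X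

variable {X}

@[simp]
theorem evBimodule_right (a b x : X) :
    (evBimodule X).right (op (ptmul X (opObj X) a (opElt X b))) (evBimoduleElt X x) =
      evBimoduleElt X (b * x * a) := rfl

@[simp]
theorem coevBimodule_left (a b x : X) :
    (coevBimodule X).left (ptmul (opObj X) X (opElt X b) a) (coevBimoduleElt X x) =
      coevBimoduleElt X (a * x * b) :=
  rfl

/-- `X ⊗ X → X` over `Xᵐᵒᵖ`, `e ↦ c ↦ c e`. -/
def pairLeft (X : Alg₂.{u} k) : evBimodule X →ₗ[k] coevBimodule X →ₗ[k] idBimodule X :=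
  ((LinearMap.mul k X).flip.compl₁₂ (evBimoduleElt X).symm.toLinearMap
    (coevBimoduleElt X).symm.toLinearMap).compr₂ (idElt X).toLinearMap

@[simp]
theorem pairLeft_apply (e c : X) :
    pairLeft X (evBimoduleElt X e) (coevBimoduleElt X c) = idElt X (c * e) := rfl

/-- `X ⊗ X → Xᵐᵒᵖ` over `X`, `e ↦ c ↦ op (e c)`. -/
def pairRight (X : Alg₂.{u} k) :
    evBimodule X →ₗ[k] coevBimodule X →ₗ[k] idBimodule (opObj X) :=
  ((LinearMap.mul k X).compl₁₂ (evBimoduleElt X).symm.toLinearMap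
    (coevBimoduleElt X).symm.toLinearMap).compr₂
      ((idElt (opObj X)).toLinearMap ∘ₗ (opElt X).toLinearMap)

@[simp]
theorem pairRight_apply (e c : X) :
    pairRight X (evBimoduleElt X e) (coevBimoduleElt X c) = idElt (opObj X) (opElt X (e * c)) := rfl

theorem pairLeft_balanced (e : evBimodule X) (y : opObj X) (c : coevBimodule X) :
    pairLeft X ((evBimodule X).right (op (ptmul _ _ 1 y)) e) c =
      pairLeft X e ((coevBimodule X).left (ptmul _ _ y 1) c) := by
  obtain ⟨e, rfl⟩ := (evBimoduleElt X).surjective e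
  obtain ⟨c, rfl⟩ := (coevBimoduleElt X).surjective c
  obtain ⟨y, rfl⟩ := (opElt X).surjective y
  rw [evBimodule_right, coevBimodule_left, pairLeft_apply, pairLeft_apply]
  simp only [mul_one, one_mul, mul_assoc]

theorem pairRight_balanced (e : evBimodule X) (x : X) (c : coevBimodule X) :
    pairRight X ((evBimodule X).right (op (ptmul _ _ x 1)) e) c =
      pairRight X e ((coevBimodule X).left (ptmul _ _ 1 x) c) := by
  obtain ⟨e, rfl⟩ := (evBimoduleElt X).surjective e
  obtain ⟨c, rfl⟩ := (coevBimoduleElt X).surjective c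
  rw [← opElt_one, evBimodule_right, coevBimodule_left, pairRight_apply, pairRight_apply]
  simp only [mul_one, one_mul, mul_assoc]

/-- `X ⊗ X ≅ X` over `Xᵐᵒᵖ`, by `e ⊗ c ↦ c e`. -/
def zigzagLeftIsoId (X : Alg₂.{u} k) :
    zigzagLeft (evBimodule X) (coevBimodule X) ≅ idBimodule X :=
  mkIso
    { lin := zliftLeft (pairLeft X) pairLeft_balanced
      map_left := fun a => LinearMap.congr_fun (f := zliftLeft (pairLeft X) pairLeft_balanced ∘ₗ
          (zigzagLeft (evBimodule X) (coevBimodule X)).left a)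
        (g := (idBimodule X).left a ∘ₗ zliftLeft (pairLeft X) pairLeft_balanced)
        (zmkLeft_ext fun e c => by
          obtain ⟨e, rfl⟩ := (evBimoduleElt X).surjective e
          obtain ⟨c, rfl⟩ := (coevBimoduleElt X).surjective c
          rw [LinearMap.comp_apply, LinearMap.comp_apply, zigzagLeft_left, zliftLeft_zmkLeft,
            zliftLeft_zmkLeft, ← opElt_one, coevBimodule_left, pairLeft_apply, pairLeft_apply,
            ofAlgHom_left, mul_one, mul_assoc])
      map_right := fun a => LinearMap.congr_fun (f := zliftLeft (pairLeft X) pairLeft_balanced ∘ₗ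
          (zigzagLeft (evBimodule X) (coevBimodule X)).right a)
        (g := (idBimodule X).right a ∘ₗ zliftLeft (pairLeft X) pairLeft_balanced)
        (zmkLeft_ext fun e c => by
          obtain ⟨e, rfl⟩ := (evBimoduleElt X).surjective e
          obtain ⟨c, rfl⟩ := (coevBimoduleElt X).surjective c
          obtain ⟨a, rfl⟩ := op_surjective a
          rw [LinearMap.comp_apply, LinearMap.comp_apply, zigzagLeft_right, zliftLeft_zmkLeft,
            zliftLeft_zmkLeft, ← opElt_one, evBimodule_right, pairLeft_apply, pairLeft_apply,
            ofAlgHom_right, one_mul, unop_op, AlgHom.id_apply, mul_assoc]) }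
    ((zmkLeft (evBimodule X) (coevBimodule X) (evBimoduleElt X 1)) ∘ₗ
      (coevBimoduleElt X).toLinearMap ∘ₗ (idElt X).symm.toLinearMap)
    (zmkLeft_ext fun e c => by
      obtain ⟨e, rfl⟩ := (evBimoduleElt X).surjective e
      obtain ⟨c, rfl⟩ := (coevBimoduleElt X).surjective c
      have h := zmkLeft_balanced (evBimoduleElt X 1) (opElt X e) (coevBimoduleElt X c)
      rw [evBimodule_right, coevBimodule_left, mul_one, mul_one, one_mul] at h
      simp [h])
    (LinearMap.ext fun x => by
      obtain ⟨x, rfl⟩ := (idElt X).surjective x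
      simp)

/-- `X ⊗_X X ≅ Xᵐᵒᵖ`, by `e ⊗ c ↦ op (e c)`. -/
def zigzagRightIsoId (X : Alg₂.{u} k) :
    zigzagRight (evBimodule X) (coevBimodule X) ≅ idBimodule (opObj X) :=
  mkIso
    { lin := zliftRight (pairRight X) pairRight_balanced
      map_left := fun a => LinearMap.congr_fun (f := zliftRight (pairRight X) pairRight_balanced ∘ₗ
          (zigzagRight (evBimodule X) (coevBimodule X)).left a)
        (g := (idBimodule (opObj X)).left a ∘ₗ zliftRight (pairRight X) pairRight_balanced)
        (zmkRight_ext fun e c => by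
          obtain ⟨e, rfl⟩ := (evBimoduleElt X).surjective e
          obtain ⟨c, rfl⟩ := (coevBimoduleElt X).surjective c
          obtain ⟨a, rfl⟩ := (opElt X).surjective a
          rw [LinearMap.comp_apply, LinearMap.comp_apply, zigzagRight_left, zliftRight_zmkRight,
            zliftRight_zmkRight, coevBimodule_left, pairRight_apply, pairRight_apply,
            ofAlgHom_left, opElt_mul, one_mul, mul_assoc])
      map_right := fun a => LinearMap.congr_fun
        (f := zliftRight (pairRight X) pairRight_balanced ∘ₗ
          (zigzagRight (evBimodule X) (coevBimodule X)).right a)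
        (g := (idBimodule (opObj X)).right a ∘ₗ zliftRight (pairRight X) pairRight_balanced)
        (zmkRight_ext fun e c => by
          obtain ⟨e, rfl⟩ := (evBimoduleElt X).surjective e
          obtain ⟨c, rfl⟩ := (coevBimoduleElt X).surjective c
          obtain ⟨a, rfl⟩ := op_surjective a
          obtain ⟨a, rfl⟩ := (opElt X).surjective a
          rw [LinearMap.comp_apply, LinearMap.comp_apply, zigzagRight_right, zliftRight_zmkRight,
            zliftRight_zmkRight, evBimodule_right, pairRight_apply, pairRight_apply,
            ofAlgHom_right, unop_op, AlgHom.id_apply, opElt_mul, mul_one, mul_assoc]) }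
    ((zmkRight (evBimodule X) (coevBimodule X) (evBimoduleElt X 1)) ∘ₗ
      (coevBimoduleElt X).toLinearMap ∘ₗ (opElt X).symm.toLinearMap ∘ₗ
      (idElt (opObj X)).symm.toLinearMap)
    (zmkRight_ext fun e c => by
      obtain ⟨e, rfl⟩ := (evBimoduleElt X).surjective e
      obtain ⟨c, rfl⟩ := (coevBimoduleElt X).surjective c
      have h := zmkRight_balanced (evBimoduleElt X 1) e (coevBimoduleElt X c)
      rw [← opElt_one, evBimodule_right, coevBimodule_left, mul_one, mul_one, one_mul] at h
      simp [h])
    (LinearMap.ext fun x => by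
      obtain ⟨x, rfl⟩ := (idElt (opObj X)).surjective x
      obtain ⟨x, rfl⟩ := (opElt X).surjective x
      simp)

/-- Every algebra is dualizable, with dual the opposite algebra. -/
theorem isDualPair_opObj (X : Alg₂.{u} k) :
    IsDualPair (X := X) (Y := opObj X) (evBimodule X) (coevBimodule X) where
  zigzag_left := ⟨zigzagLeftIso (evBimodule X) (coevBimodule X) ≪≫ zigzagLeftIsoId X⟩
  zigzag_right := ⟨zigzagRightIso (evBimodule X) (coevBimodule X) ≪≫ zigzagRightIsoId X⟩

end Dual

/-! ### Adjunctions of bimodules -/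

section Adjunction

section Bicategory

variable {B : Type*} [Bicategory B] {a b : B} {f : a ⟶ b} {g : b ⟶ a} (η : 𝟙 a ⟶ f ≫ g)
  (ζ : g ≫ f ⟶ 𝟙 b)

open Bicategory

theorem leftZigzag_eq : leftZigzag η ζ = η ▷ f ≫ (α_ f g f).hom ≫ f ◁ ζ := by
  simp [bicategoricalComp]

theorem rightZigzag_eq : rightZigzag η ζ = g ◁ η ≫ (α_ g f g).inv ≫ ζ ▷ g := by
  simp [bicategoricalComp]

end Bicategory

variable {R S : Alg₂.{u} k}

/-- A perfect pairing between finite-dimensional bimodules `N` and `M`, for which the right actions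
on one are adjoint to the left actions on the other, given with dual bases `n` of `N` and `m`
of `M`. -/
structure DualBases (M : Bimodule R S) (N : Bimodule S R) (ι : Type*) [Fintype ι] where
  /-- the pairing -/
  pair : N →ₗ[k] M →ₗ[k] k
  pair_left (r : R) (y : N) (x : M) : pair (N.left r y) x = pair y (M.right (op r) x)
  pair_right (s : S) (y : N) (x : M) : pair (N.right (op s) y) x = pair y (M.left s x)
  /-- the basis of `M` -/
  m : ι → M
  /-- the basis of `N` -/
  n : ι → N
  sum_m (x : M) : ∑ i, pair (n i) x • m i = x
  sum_n (y : N) : ∑ i, pair y (m i) • n i = y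

namespace DualBases

variable {M : Bimodule R S} {N : Bimodule S R} {ι : Type*} [Fintype ι] (β : DualBases M N ι)

/-- The same pairing, with the roles of `M` and `N` exchanged. -/
def symm : DualBases N M ι where
  pair := β.pair.flip
  pair_left s x y := (β.pair_right s y x).symm
  pair_right r x y := (β.pair_left r y x).symm
  m := β.n
  n := β.m
  sum_m := β.sum_n
  sum_n := β.sum_m

/-- The canonical element `∑ nᵢ ⊗ mᵢ` turns an endomorphism of `N` into its adjoint on `M`. -/
theorem sum_adjoint {P : Type*} [AddCommGroup P] [Module k P] (f : N →ₗ[k] M →ₗ[k] P)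
    (T : M →ₗ[k] M) (T' : N →ₗ[k] N) (h : ∀ y x, β.pair (T' y) x = β.pair y (T x)) :
    ∑ i, f (T' (β.n i)) (β.m i) = ∑ i, f (β.n i) (T (β.m i)) := by
  have h₁ : ∀ i, f (T' (β.n i)) (β.m i) =
      ∑ j, β.pair (β.n i) (T (β.m j)) • f (β.n j) (β.m i) := fun i => by
    conv_lhs => rw [← β.sum_n (T' (β.n i))]
    simp [h]
  have h₂ : ∀ j, f (β.n j) (T (β.m j)) =
      ∑ i, β.pair (β.n i) (T (β.m j)) • f (β.n j) (β.m i) := fun j => by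
    conv_lhs => rw [← β.sum_m (T (β.m j))]
    simp
  simp only [h₁, h₂]
  exact Finset.sum_comm

/-- `r ↦ ∑ nᵢ ⊗ mᵢ r`. -/
def coev : idBimodule R ⟶ tensorOver N M where
  lin := ∑ i, tmk N M (β.n i) ∘ₗ M.right.toLinearMap.flip (β.m i) ∘ₗ
    (opLinearEquiv k).toLinearMap ∘ₗ (idElt R).symm.toLinearMap
  map_left s x := by
    obtain ⟨x, rfl⟩ := (idElt R).surjective x
    have h := β.sum_adjoint ((tmk N M).compl₂ (M.right (op x))) (M.right (op s)) (N.left s)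
      (β.pair_left s)
    simpa [map_sum] using h.symm
  map_right r x := by
    obtain ⟨x, rfl⟩ := (idElt R).surjective x
    obtain ⟨r, rfl⟩ := op_surjective r
    simp [map_sum]

@[simp]
theorem coev_one : β.coev.lin (idElt R 1) = ∑ i, tmk N M (β.n i) (β.m i) := by
  simp [coev]

/-- The `S`-valued pairing `x ↦ y ↦ ∑ ⟨y, bᵢ x⟩ aᵢ` for `t = ∑ aᵢ ⊗ bᵢ`. -/
def contract : S ⊗[k] S →ₗ[k] M →ₗ[k] N →ₗ[k] S :=
  TensorProduct.lift (LinearMap.mk₂ k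
    (fun a b => (β.pair.flip ∘ₗ M.left b).compr₂ (LinearMap.toSpanSingleton k S a))
    (fun a a' b => by ext; simp) (fun c a b => by ext; simp [smul_comm c])
    (fun a b b' => by ext; simp [add_smul]) (fun c a b => by ext; simp [mul_smul]))

theorem contract_tmul (a b : S) (x : M) (y : N) :
    β.contract (a ⊗ₜ b) x y = β.pair y (M.left b x) • a := by
  simp [contract]

theorem contract_left (t : S ⊗[k] S) (s : S) (x : M) (y : N) :
    β.contract t (M.left s x) y = β.contract (t * (1 ⊗ₜ s)) x y := by
  induction t with
  | zero => simp
  | add t t' h h' => simp only [add_mul, map_add, LinearMap.add_apply, h, h']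
  | tmul a b => simp [contract_tmul]

theorem contract_right (t : S ⊗[k] S) (s : S) (x : M) (y : N) :
    β.contract t x (N.right (op s) y) = β.contract ((1 ⊗ₜ s) * t) x y := by
  induction t with
  | zero => simp
  | add t t' h h' => simp only [mul_add, map_add, LinearMap.add_apply, h, h']
  | tmul a b => simp [contract_tmul, β.pair_right]

theorem mul_contract (t : S ⊗[k] S) (s : S) (x : M) (y : N) :
    s * β.contract t x y = β.contract ((s ⊗ₜ 1) * t) x y := by
  induction t with
  | zero => simp
  | add t t' h h' => simp only [mul_add, map_add, LinearMap.add_apply, h, h']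
  | tmul a b => simp [contract_tmul]

theorem contract_mul (t : S ⊗[k] S) (s : S) (x : M) (y : N) :
    β.contract t x y * s = β.contract (t * (s ⊗ₜ 1)) x y := by
  induction t with
  | zero => simp
  | add t t' h h' => simp only [add_mul, map_add, LinearMap.add_apply, h, h']
  | tmul a b => simp [contract_tmul]

theorem contract_balanced (t : S ⊗[k] S) (r : R) (x : M) (y : N) :
    β.contract t (M.right (op r) x) y = β.contract t x (N.left r y) := by
  induction t with
  | zero => simp
  | add t t' h h' => simp only [map_add, LinearMap.add_apply, h, h']
  | tmul a b => simp [contract_tmul, β.pair_left, M.comm]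

theorem sum_contract_left (t : S ⊗[k] S) (x : M) :
    ∑ i, M.left (β.contract t x (β.n i)) (β.m i) = M.left (LinearMap.mul' k S t) x := by
  induction t with
  | zero => simp
  | add t t' h h' => simp only [map_add, LinearMap.add_apply, Finset.sum_add_distrib, h, h']
  | tmul a b =>
    conv_rhs => rw [LinearMap.mul'_apply, map_mul, Module.End.mul_apply, ← β.sum_m (M.left b x)]
    simp [contract_tmul]

theorem sum_contract_right (t : S ⊗[k] S) (y : N) :
    ∑ i, N.right (op (β.contract t (β.m i) y)) (β.n i) =
      N.right (op (LinearMap.mul' k S (TensorProduct.comm k S S t))) y := by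
  induction t with
  | zero => simp
  | add t t' h h' =>
    simp only [map_add, LinearMap.add_apply, Finset.sum_add_distrib, MulOpposite.op_add, h, h']
  | tmul a b =>
    conv_rhs => rw [TensorProduct.comm_tmul, LinearMap.mul'_apply, op_mul, map_mul,
      Module.End.mul_apply, ← β.sum_n (N.right (op b) y)]
    simp [contract_tmul, β.pair_right]

/-- `x ⊗ y ↦ ∑ ⟨y, bᵢ x⟩ aᵢ` for a symmetric separability element `e = ∑ aᵢ ⊗ bᵢ` of `S`. -/
def ev {e : S ⊗[k] S} (he : IsSeparabilityElement e) (hc : TensorProduct.comm k S S e = e) :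
    tensorOver M N ⟶ idBimodule S :=
  tdesc ((β.contract e).compr₂ (idElt S).toLinearMap)
    (fun x r y => by simp [contract_balanced])
    (fun s x y => by
      simp only [LinearMap.compr₂_apply, LinearEquiv.coe_coe, ofAlgHom_left]
      rw [contract_left, mul_contract, he.tmul_one_mul])
    (fun s x y => by
      obtain ⟨s, rfl⟩ := op_surjective s
      simp only [LinearMap.compr₂_apply, LinearEquiv.coe_coe, ofAlgHom_right]
      rw [contract_right, unop_op, AlgHom.id_apply, contract_mul, he.one_tmul_mul hc])

@[simp]
theorem ev_tmk {e : S ⊗[k] S} (he : IsSeparabilityElement e)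
    (hc : TensorProduct.comm k S S e = e) (x : M) (y : N) :
    (β.ev he hc).lin (tmk M N x y) = idElt S (β.contract e x y) :=
  tdesc_tmk _ _ _ _ x y

/-- A symmetric separability element of `S` makes `N` right adjoint to `M`. -/
def adjunction {e : S ⊗[k] S} (he : IsSeparabilityElement e)
    (hc : TensorProduct.comm k S S e = e) :
    Bicategory.Adjunction (a := R) (b := S) M N where
  unit := β.coev
  counit := β.ev he hc
  left_triangle := by
    rw [leftZigzag_eq]
    change mapRight M β.coev ≫ (assocIso M N M).hom ≫ mapLeft (β.ev he hc) M =
      (idRight M).hom ≫ (idLeft M).inv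
    refine tensorOver_hom_ext fun x r => ?_
    obtain ⟨r, rfl⟩ := (idElt R).surjective r
    rw [← tmk_idElt_right]
    have h := β.sum_contract_left e (M.right (op r) x)
    rw [he.mul'_eq_one, map_one, Module.End.one_apply] at h
    simp only [comp_lin, LinearMap.comp_apply, mapRight_tmk, coev_one, map_sum, assocIso_hom_tmk,
      mapLeft_tmk, ev_tmk, idRight_hom_tmk, idLeft_inv, op_one, map_one, Module.End.one_apply]
    rw [Finset.sum_congr rfl fun i _ => (tmk_idElt_left M (β.contract e _ (β.n i)) (β.m i)).symm,
      ← map_sum, h]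
  right_triangle := by
    rw [rightZigzag_eq]
    change mapLeft β.coev N ≫ (assocIso N M N).inv ≫ mapRight N (β.ev he hc) =
      (idLeft N).hom ≫ (idRight N).inv
    refine tensorOver_hom_ext fun r y => ?_
    obtain ⟨r, rfl⟩ := (idElt R).surjective r
    rw [← tmk_idElt_left]
    have h := β.sum_contract_right e (N.left r y)
    rw [hc, he.mul'_eq_one, op_one, map_one, Module.End.one_apply] at h
    simp only [comp_lin, LinearMap.comp_apply, mapLeft_tmk, coev_one, map_sum, LinearMap.sum_apply,
      assocIso_inv_tmk, mapRight_tmk, ev_tmk, idLeft_hom_tmk, idRight_inv, map_one,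
      Module.End.one_apply]
    rw [Finset.sum_congr rfl fun i _ => (tmk_idElt_right N (β.n i) (β.contract e (β.m i) _)).symm,
      ← LinearMap.sum_apply, ← map_sum, h]

end DualBases

/-- The `R`-`S`-bimodule of linear forms on `M`, with `(r φ s) x = φ (s x r)`. -/
def dualBimodule (M : Bimodule R S) : Bimodule S R where
  carrier := Module.Dual k M
  left := AlgHom.ofLinearMap
    { toFun := fun r => (M.right (op r)).dualMap
      map_add' := fun a b => by ext; simp
      map_smul' := fun a b => by ext; simp }
    (by ext; simp) (fun a b => by ext; simp)
  right := AlgHom.ofLinearMap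
    { toFun := fun s => (M.left (unop s)).dualMap
      map_add' := fun a b => by ext; simp
      map_smul' := fun a b => by ext; simp }
    (by ext; simp) (fun a b => by ext; simp)
  comm r s φ := LinearMap.ext fun x => congrArg φ (M.comm (unop s) (op r) x)

/-- Dual bases of `M` and its dual. -/
noncomputable def dualBases (M : Bimodule R S) [Module.Finite k M] :
    DualBases M (dualBimodule M) (Fin (Module.finrank k M)) where
  pair := (LinearMap.id : Module.Dual k M →ₗ[k] Module.Dual k M)
  pair_left _ _ _ := rfl
  pair_right _ _ _ := rfl
  m := Module.finBasis k M
  n := (Module.finBasis k M).coord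
  sum_m := (Module.finBasis k M).sum_repr
  sum_n φ := (Module.finBasis k M).sum_dual_apply_smul_coord φ

/-- A finite-dimensional bimodule has a finite-dimensional right adjoint, its linear dual, if the
algebra acting on its left has a symmetric separability element. -/
theorem exists_rightAdjoint (M : Bimodule R S) [Module.Finite k M]
    (hS : IsSymmetricallySeparable k S) : ∃ N : Bimodule S R, Module.Finite k N ∧
      Nonempty (Bicategory.Adjunction (a := R) (b := S) M N) :=
  have ⟨_, he, hc⟩ := hS
  ⟨dualBimodule M, inferInstanceAs (Module.Finite k (Module.Dual k M)),
    ⟨(dualBases M).adjunction he hc⟩⟩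

/-- A finite-dimensional bimodule has a finite-dimensional left adjoint, its linear dual, if the
algebra acting on its right has a symmetric separability element. -/
theorem exists_leftAdjoint (M : Bimodule R S) [Module.Finite k M]
    (hR : IsSymmetricallySeparable k R) : ∃ N : Bimodule S R, Module.Finite k N ∧
      Nonempty (Bicategory.Adjunction (a := S) (b := R) N M) :=
  have ⟨_, he, hc⟩ := hR
  ⟨dualBimodule M, inferInstanceAs (Module.Finite k (Module.Dual k M)),
    ⟨(dualBases M).symm.adjunction he hc⟩⟩

end Adjunction

/-! ### Separability from an adjoint of the evaluation -/

section Necessity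

theorem exists_finset_tmk {R S T : Alg₂.{u} k} {N : Bimodule S T} {M : Bimodule R S}
    (t : tensorOver N M) : ∃ s : Finset (N × M), t = ∑ p ∈ s, tmk N M p.1 p.2 := by
  obtain ⟨t, rfl⟩ := (balancedRel N M).mkQ_surjective t
  obtain ⟨s, rfl⟩ := TensorProduct.exists_finset t
  exact ⟨s, map_sum _ _ _⟩

/-- The triangle identity on the right adjoint `G`, in terms of elements: if the unit is
`1 ↦ ∑ gᵢ ⊗ fᵢ`, then `y = ∑ gᵢ ε(fᵢ ⊗ y)` for the counit `ε`. -/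
theorem sum_right_counit {R S : Alg₂.{u} k} {F : Bimodule R S} {G : Bimodule S R}
    (adj : Bicategory.Adjunction (a := R) (b := S) F G) {s : Finset (G × F)}
    (hs : Intertwiner.lin (M := idBimodule R) (N := tensorOver G F) adj.unit (idElt R 1) =
      ∑ p ∈ s, tmk G F p.1 p.2) (y : G) :
    ∑ p ∈ s, G.right (op ((idElt S).symm
      (Intertwiner.lin (M := tensorOver F G) (N := idBimodule S) adj.counit (tmk F G p.2 y)))) p.1
        = y := by
  let unit : idBimodule R ⟶ tensorOver G F := adj.unit
  let counit : tensorOver F G ⟶ idBimodule S := adj.counit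
  have h₁ := adj.right_triangle
  rw [rightZigzag_eq] at h₁
  have h₂ : mapLeft unit G ≫ (assocIso G F G).inv ≫ mapRight G counit =
    (idLeft G).hom ≫ (idRight G).inv := h₁
  have h₃ := congrArg (fun f => (idRight G).hom.lin (Intertwiner.lin f (tmk _ G (idElt R 1) y))) h₂
  have h₄ : unit.lin (idElt R 1) = ∑ p ∈ s, tmk G F p.1 p.2 := hs
  simp only [comp_lin, LinearMap.comp_apply, mapLeft_tmk, h₄, map_sum, LinearMap.sum_apply,
    assocIso_inv_tmk, mapRight_tmk, idLeft_hom_tmk, idRight_inv, idRight_hom_tmk, map_one,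
    Module.End.one_apply, op_one] at h₃
  refine Eq.trans (Finset.sum_congr rfl fun p _ => ?_) h₃
  obtain ⟨z, hz⟩ := (idElt S).surjective (counit.lin (tmk F G p.2 y))
  change G.right (op ((idElt S).symm (counit.lin (tmk F G p.2 y)))) p.1 = _
  rw [← hz, idRight_hom_tmk, LinearEquiv.symm_apply_apply]

variable {X Y : Alg₂.{u} k} {E : Bimodule (tensorObj X Y) (unitObj k)}
  {C : Bimodule (unitObj k) (tensorObj Y X)}

/-- `x ⊗ y ↦ c ↦ b (y c) ⊗ x`. -/
def twistPair (b : C →ₗ[k] X) : tensorObj X Y →ₗ[k] C →ₗ[k] X ⊗[k] X :=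
  TensorProduct.lift (LinearMap.mk₂ k
    (fun x y => (TensorProduct.mk k X X).flip x ∘ₗ b ∘ₗ C.left (ptmul Y X y 1))
    (fun x x' y => by ext; simp) (fun r x y => by ext; simp)
    (fun x y y' => by ext; simp) (fun r x y => by ext; simp [smul_tmul']))

theorem twistPair_ptmul (b : C →ₗ[k] X) (x : X) (y : Y) (c : C) :
    twistPair b (ptmul X Y x y) c = b (C.left (ptmul Y X y 1) c) ⊗ₜ x := rfl

theorem twistPair_mul_left (b : C →ₗ[k] X) (s : tensorObj X Y) (x : X) (c : C) :
    twistPair b (s * ptmul X Y x 1) c = twistPair b s c * (1 ⊗ₜ x) := by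
  induction s using ptmul_induction with
  | zero => simp
  | add s t hs ht => simp only [add_mul, map_add, LinearMap.add_apply, hs, ht]
  | ptmul a y => simp [ptmul_mul, twistPair_ptmul]

theorem twistPair_mul_right (b : C →ₗ[k] X) (s : tensorObj X Y) (y : Y) (c : C) :
    twistPair b (s * ptmul X Y 1 y) c = twistPair b s (C.left (ptmul Y X y 1) c) := by
  induction s using ptmul_induction with
  | zero => simp
  | add s t hs ht => simp only [add_mul, map_add, LinearMap.add_apply, hs, ht]
  | ptmul a y' => simp [ptmul_mul, twistPair_ptmul, left_ptmul_ptmul]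

theorem twistPair_left (b : C →ₗ[k] X) (hb : ∀ x c, b (C.left (ptmul Y X 1 x) c) = x * b c)
    (s : tensorObj X Y) (x : X) (c : C) :
    twistPair b s (C.left (ptmul Y X 1 x) c) = (x ⊗ₜ 1) * twistPair b s c := by
  induction s using ptmul_induction with
  | zero => simp
  | add s t hs ht => simp only [mul_add, map_add, LinearMap.add_apply, hs, ht]
  | ptmul a y =>
    have h := hb x (C.left (ptmul Y X y 1) c)
    rw [left_ptmul_ptmul, one_mul, mul_one] at h
    simp [twistPair_ptmul, left_ptmul_ptmul, h]

/-- If `E ⊗_Y C ≅ X` and `E` has a left adjoint, then `X` has a separability element. The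
adjunction expands `e = ∑ eᵢ ε(gᵢ ⊗ e)` with coefficients in `X ⊗ Y`. Moving the `Y`-parts of the
coefficients over to `C` and keeping the `X`-parts splits the multiplication `X ⊗ X → X` as a map
of bimodules. -/
theorem exists_isSeparabilityElement (θ : zigzagLeft E C ≅ idBimodule X)
    {G : Bimodule (unitObj k) (tensorObj X Y)}
    (adj : Bicategory.Adjunction (a := unitObj k) (b := tensorObj X Y) G E) :
    ∃ e : X ⊗[k] X, IsSeparabilityElement e := by
  -- the pairing `⟨e, c⟩` given by `θ`
  let b : E →ₗ[k] C →ₗ[k] X :=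
    (zmkLeft E C).compr₂ ((idElt X).symm.toLinearMap ∘ₗ θ.hom.lin)
  have hb : ∀ e c, θ.hom.lin (zmkLeft E C e c) = idElt X (b e c) := fun e c => rfl
  have hbl : ∀ e x c, b e (C.left (ptmul Y X 1 x) c) = x * b e c := fun e x c => by
    apply (idElt X).injective
    rw [← hb, ← zigzagLeft_left, θ.hom.map_left, hb, ofAlgHom_left]
  have hbr : ∀ e x c, b (E.right (op (ptmul X Y x 1)) e) c = b e c * x := fun e x c => by
    apply (idElt X).injective
    rw [← hb, ← zigzagLeft_right, θ.hom.map_right, hb, ofAlgHom_right]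
    rfl
  have hbb : ∀ e y c, b (E.right (op (ptmul X Y 1 y)) e) c = b e (C.left (ptmul Y X y 1) c) :=
    fun e y c => by
      apply (idElt X).injective
      rw [← hb, ← hb, zmkLeft_balanced]
  have hmul : ∀ e s c, LinearMap.mul' k X (twistPair (b e) s c) = b (E.right (op s) e) c :=
    fun e s c => by
      induction s using ptmul_induction with
      | zero => simp
      | add s t hs ht => simp only [map_add, MulOpposite.op_add, LinearMap.add_apply, hs, ht]
      | ptmul x y =>
        have h := right_ptmul_ptmul E x 1 1 y e
        rw [one_mul, mul_one] at h
        rw [twistPair_ptmul, LinearMap.mul'_apply, ← h, hbr, hbb]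
  let unit : idBimodule (unitObj k) ⟶ tensorOver E G := adj.unit
  let counit : tensorOver G E ⟶ idBimodule (tensorObj X Y) := adj.counit
  let ε : G →ₗ[k] E →ₗ[k] tensorObj X Y :=
    (tmk G E).compr₂ ((idElt (tensorObj X Y)).symm.toLinearMap ∘ₗ counit.lin)
  have hε : ∀ g e s, ε g (E.right (op s) e) = ε g e * s := fun g e s => by
    apply (idElt (tensorObj X Y)).injective
    have h := counit.map_right (op s) (tmk G E g e)
    rw [tensorOver_right] at h
    exact h
  obtain ⟨S, hS⟩ := exists_finset_tmk (unit.lin (idElt (unitObj k) 1))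
  have hsum : ∀ e, ∑ p ∈ S, E.right (op (ε p.2 e)) p.1 = e := sum_right_counit adj hS
  let f : E →ₗ[k] C →ₗ[k] X ⊗[k] X := ∑ p ∈ S, twistPair (b p.1) ∘ₗ ε p.2
  have hf : ∀ e c, f e c = ∑ p ∈ S, twistPair (b p.1) (ε p.2 e) c := fun e c => by simp [f]
  -- `W (e ⊗ c) = ∑ ⟨eᵢ, yᵢ c⟩ ⊗ aᵢ`, where `ε(gᵢ ⊗ e) = aᵢ ⊗ yᵢ`: a bimodule map whose composite
  -- with the multiplication is `θ`
  let W : zigzagLeft E C →ₗ[k] X ⊗[k] X := zliftLeft f fun e y c => by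
    simp only [hf, hε, twistPair_mul_right]
  have hW : ∀ e c, W (zmkLeft E C e c) = f e c := zliftLeft_zmkLeft f _
  have hWl : ∀ x z, W ((zigzagLeft E C).left x z) = (x ⊗ₜ 1) * W z := fun x =>
    LinearMap.congr_fun (f := W ∘ₗ (zigzagLeft E C).left x)
      (g := LinearMap.mulLeft k (x ⊗ₜ[k] (1 : X)) ∘ₗ W) (zmkLeft_ext fun e c => by
        simp only [LinearMap.comp_apply, zigzagLeft_left, hW, hf, twistPair_left _ (hbl _),
          LinearMap.mulLeft_apply, Finset.mul_sum])
  have hWr : ∀ x z, W ((zigzagLeft E C).right (op x) z) = W z * (1 ⊗ₜ x) := fun x =>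
    LinearMap.congr_fun (f := W ∘ₗ (zigzagLeft E C).right (op x))
      (g := LinearMap.mulRight k ((1 : X) ⊗ₜ[k] x) ∘ₗ W) (zmkLeft_ext fun e c => by
        simp only [LinearMap.comp_apply, zigzagLeft_right, hW, hf, hε, twistPair_mul_left,
          LinearMap.mulRight_apply, Finset.sum_mul])
  have hWm : ∀ z, LinearMap.mul' k X (W z) = (idElt X).symm (θ.hom.lin z) :=
    LinearMap.congr_fun (f := LinearMap.mul' k X ∘ₗ W)
      (g := (idElt X).symm.toLinearMap ∘ₗ θ.hom.lin) (zmkLeft_ext fun e c => by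
        simp only [LinearMap.comp_apply, hW, hf, map_sum, hmul, LinearEquiv.coe_coe, hb,
          LinearEquiv.symm_apply_apply]
        simp only [← LinearMap.sum_apply, ← map_sum, hsum])
  refine ⟨W (θ.inv.lin (idElt X 1)), ?_, fun a => ?_⟩
  · have h : θ.hom.lin (θ.inv.lin (idElt X 1)) = idElt X 1 :=
      LinearMap.congr_fun (congrArg Intertwiner.lin θ.inv_hom_id) _
    rw [hWm, h, LinearEquiv.symm_apply_apply]
  · rw [← hWl, ← hWr, ← θ.inv.map_left, ← θ.inv.map_right, ofAlgHom_left, ofAlgHom_right]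
    simp

end Necessity

/-! ### The sub-2-category of separable algebras -/

theorem isSymmetricallySeparable_unitObj (k : Type) [Field k] :
    IsSymmetricallySeparable k (unitObj.{u} k) :=
  .of_algEquiv (ULift.algEquiv (R := k) (A := k)).symm .self

/-- The sub-2-category of the algebras with a symmetric separability element and the
finite-dimensional bimodules between them. -/
def separableSub (k : Type) [Field k] : SymmetricMonoidalSub.{u} k where
  obj X := IsSymmetricallySeparable k X
  hom {X Y} f := IsSymmetricallySeparable k X ∧ IsSymmetricallySeparable k Y ∧
    Module.Finite k (Bimodule.carrier f)
  obj_src _ h := h.1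
  obj_tgt _ h := h.2.1
  hom_iso {X Y} f g := by
    rintro ⟨i⟩ ⟨hX, hY, hf⟩
    refine ⟨hX, hY, ?_⟩
    let i' : (show Bimodule X Y from f) ≅ g := i
    exact Module.Finite.of_surjective i'.hom.lin fun x =>
      ⟨i'.inv.lin x, LinearMap.congr_fun (congrArg Intertwiner.lin i'.inv_hom_id) x⟩
  hom_id X hX := ⟨hX, hX, hX.moduleFinite⟩
  hom_comp {X Y Z} f g hf hg := by
    have := hf.2.2
    have := hg.2.2
    exact ⟨hf.1, hg.2.1, Module.Finite.of_surjective (balancedRel g f).mkQ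
      (Submodule.mkQ_surjective _)⟩
  obj_unit := isSymmetricallySeparable_unitObj k
  obj_tensor _ _ hX hY := hX.tensor hY
  hom_tensor f g hf hg := by
    have := hf.2.2
    have := hg.2.2
    exact ⟨hf.1.tensor hg.1, hf.2.1.tensor hg.2.1, inferInstanceAs
      (Module.Finite k (Bimodule.carrier f ⊗[k] Bimodule.carrier g))⟩
  hom_assoc X Y Z hX hY hZ :=
    have h₁ := (hX.tensor hY).tensor hZ
    have h₂ := hX.tensor (hY.tensor hZ)
    ⟨⟨h₁, h₂, h₂.moduleFinite⟩, ⟨h₂, h₁, h₁.moduleFinite⟩⟩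
  hom_leftUnit X hX :=
    have h := (isSymmetricallySeparable_unitObj.{u} k).tensor hX
    ⟨⟨h, hX, hX.moduleFinite⟩, ⟨hX, h, h.moduleFinite⟩⟩
  hom_rightUnit X hX :=
    have h := hX.tensor (isSymmetricallySeparable_unitObj.{u} k)
    ⟨⟨h, hX, hX.moduleFinite⟩, ⟨hX, h, h.moduleFinite⟩⟩
  hom_braid X Y hX hY := ⟨hX.tensor hY, hY.tensor hX, (hY.tensor hX).moduleFinite⟩

theorem separableSub_hasDuals (k : Type) [Field k] : (separableSub.{u} k).HasDuals where
  exists_dual X hX := by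
    have hu := (separableSub.{u} k).obj_unit
    have hop : IsSymmetricallySeparable k (opObj X) := hX.op
    exact ⟨opObj X, evBimodule X, coevBimodule X, hop, ⟨hX.tensor hop, hu, hX.moduleFinite⟩,
      ⟨hu, hop.tensor hX, hX.moduleFinite⟩, isDualPair_opObj X⟩
  exists_rightAdjoint {X Y} f := by
    rintro ⟨hX, hY, hf⟩
    obtain ⟨g, hg, adj⟩ := exists_rightAdjoint (R := X) (S := Y) f hY
    exact ⟨g, ⟨hY, hX, hg⟩, adj⟩
  exists_leftAdjoint {X Y} f := by
    rintro ⟨hX, hY, hf⟩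
    obtain ⟨g, hg, adj⟩ := exists_leftAdjoint (R := X) (S := Y) f hX
    exact ⟨g, ⟨hY, hX, hg⟩, adj⟩

theorem IsFullyDualizable.hasDualWithAdjointEvaluation {X : Alg₂.{u} k}
    (h : IsFullyDualizable X) : HasDualWithAdjointEvaluation X := by
  obtain ⟨S, hS, hX⟩ := h
  obtain ⟨Y, ev, coev, -, hev, -, hd⟩ := hS.exists_dual X hX
  obtain ⟨l, -, hl⟩ := hS.exists_leftAdjoint ev hev
  obtain ⟨r, -, hr⟩ := hS.exists_rightAdjoint ev hev
  exact ⟨Y, ev, coev, hd, ⟨l, hl⟩, ⟨r, hr⟩⟩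

theorem HasDualWithAdjointEvaluation.exists_isSeparabilityElement {X : Alg₂.{u} k}
    (h : HasDualWithAdjointEvaluation X) : ∃ e : X ⊗[k] X, IsSeparabilityElement e := by
  obtain ⟨Y, ev, coev, ⟨⟨θ⟩, -⟩, ⟨g, ⟨adj⟩⟩, -⟩ := h
  exact Alg₂.exists_isSeparabilityElement (E := ev) (C := coev)
    ((zigzagLeftIso ev coev).symm ≪≫ θ) adj

end Alg₂

theorem mainTheorem3 (A : Type u) [Ring A] [Algebra ℂ A] :
    (Alg₂.IsFullyDualizable (Alg₂.of A : Alg₂.{u} ℂ) ↔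
      IsSemisimpleRing A ∧ Module.Finite ℂ A) ∧
    (Alg₂.HasDualWithAdjointEvaluation (Alg₂.of A : Alg₂.{u} ℂ) ↔
      IsSemisimpleRing A ∧ Module.Finite ℂ A) := by
  have h₁ : IsSemisimpleRing A ∧ Module.Finite ℂ A →
      Alg₂.IsFullyDualizable (Alg₂.of A : Alg₂.{u} ℂ) := fun ⟨_, _⟩ =>
    ⟨Alg₂.separableSub ℂ, Alg₂.separableSub_hasDuals ℂ,
      IsSemisimpleRing.isSymmetricallySeparable ℂ A⟩
  have h₂ : Alg₂.HasDualWithAdjointEvaluation (Alg₂.of A : Alg₂.{u} ℂ) →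
      IsSemisimpleRing A ∧ Module.Finite ℂ A := fun h =>
    have ⟨_, he⟩ := h.exists_isSeparabilityElement
    ⟨he.isSemisimpleRing, he.moduleFinite⟩
  exact ⟨⟨fun h => h₂ h.hasDualWithAdjointEvaluation, h₁⟩,
    ⟨h₂, fun h => (h₁ h).hasDualWithAdjointEvaluation⟩⟩
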